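/- Let $G=(V,E)$ be a finite directed plane graph, embedded on the sphere, with face set $H$; $G$ need not be connected. Let $c(e)\in\mathbb R$ be arc costs, $\ell(e)\ge 0$ lower bounds and $u(e)\in\mathbb R\cup\{\infty\}$ capacities with $\ell(e)\le u(e)$. The min-cost circulation problem is $$\textstyle(\mathrm C)\quad \min\sum_{e\in E}c(e)f(e)\quad\text{s.t.}\quad \sum_{e\in \mathrm{out}(v)}f(e)-\sum_{e\in \mathrm{in}(v)}f(e)=0\ (v\in V),\qquad \ell(e)\le f(e)\le u(e)\ (e\in E).$$ The dual graph $G^*$ has vertex set $H$ and, for every $e\in E$, a dual arc $e^*$ from the face to the left of $e$ to the face to the right of $e$. Every $e$ has a forward dart, of capacity $u(e)$, and a backward dart, directed oppositely, of capacity $-\ell(e)$. A dart $d$ with face $g$ on its left and face $h$ on its right has the dual dart $(g,h)$; write $u(d)$ for its capacity and call $d$ capacitated if $u(d)<\infty$. The cost $c(h)$ of a face $h$ is the sum of $c(e)$ over the arcs $e$ with $h$ on their right minus the sum of $c(e)$ over the arcs $e$ with $h$ on their left. The potential problem is $$\textstyle(\mathrm P)\quad \min\sum_{h\in H}c(h)\pi(h)\quad\text{s.t.}\quad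 \pi(h)-\pi(g)\le u(d)\ \text{ for every capacitated dart } d \text{ with dual dart } (g,h).$$ For $\pi\in\mathbb R^H$ let $f_\pi(e)$ be the value of $\pi$ at the face to the right of $e$ minus its value at the face to the left of $e$. Let $G^{\mathrm{lpd}}$ be the network with vertex set $H$, with an arc $(g,h)$ of cost $u(d)$, lower bound $0$ and capacity $\infty$ for every capacitated dart $d$ with dual dart $(g,h)$, and with balance $c(h)$ at $h$. (These balances sum to $0$.) Its min-cost flow problem is $$\textstyle(\mathrm D)\quad \min\sum_{a}u(a)\phi(a)\quad\text{s.t.}\quad \sum_{a\in \mathrm{out}(h)}\phi(a)-\sum_{a\in \mathrm{in}(h)}\phi(a)=c(h)\ (h\in H),\qquad \phi(a)\ge 0 .$$ Then: 1. $f_\pi$ is feasible for $(\mathrm C)$ if and only if $\pi$ is feasible for $(\mathrm P)$; the cost of $f_\pi$ is $\sum_h c(h)\pi(h)$; and every feasible circulation equals $f_\pi$ for some $\pi$. 2. The linear programming dual of $(\mathrm P)$, written as $\max\sum_h -c(h)\pi(h)$ under the same constraints, is exactly $(\mathrm D)$. $(\mathrm D)$ is a min-cost transshipment problem, and $G^{\mathrm{lpd}}$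 is planar. 3. The arcs of $G^{\mathrm{lpd}}$ are, for every $e\in E$, the reverse of $e^*$, with cost $-\ell(e)$, and, if $u(e)<\infty$, also $e^*$ in its proper direction, with cost $u(e)$. In particular there are at most $2|E|$ arcs. 4. With the conventions $\inf\emptyset=+\infty$ and $-\infty$ for unbounded problems, $(\mathrm C)$ and $(\mathrm P)$ have the same optimal value, and if $(\mathrm C)$ or $(\mathrm D)$ is feasible, then this value is the negative of the optimal value of $(\mathrm D)$. If $(\mathrm C)$ and $(\mathrm D)$ are both feasible, then $(\mathrm C)$, $(\mathrm P)$ and $(\mathrm D)$ all have optimal solutions. 5. $\pi$ is optimal for $(\mathrm P)$ if and only if $f_\pi$ is optimal for $(\mathrm C)$. If $\phi$ is optimal for $(\mathrm D)$, then $\pi$ is optimal for $(\mathrm P)$ if and only if, for every arc $a=(g,h)$ of $G^{\mathrm{lpd}}$, $\pi(h)\le\pi(g)+u(a)$ and, whenever $\phi(a)>0$, also $\pi(g)\le\pi(h)-u(a)$. -/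

import Mathlib

namespace PlanarDuality

/-! ### Directed multigraphs and their sphere embeddings -/

/-- A directed multigraph with vertex type `V` and arc type `E`
(loops, parallel and antiparallel arcs are allowed). -/
structure MultiDigraph (V E : Type*) where
  tail : E → V
  head : E → V

/-- The two darts of every arc: `(e, true)` is the forward dart of `e`,
`(e, false)` is its backward dart. -/
abbrev Dart (E : Type*) := E × Bool

/-- The opposite dart. -/
def Dart.rev {E : Type*} (d : Dart E) : Dart E := (d.1, !d.2)

namespace MultiDigraph

variable {V E : Type*}

/-- The vertex a dart emanates from. -/
def src (G : MultiDigraph V E) (d : Dart E) : V := if d.2 then G.tail d.1 else G.head d.1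

/-- The vertex a dart terminates at. -/
def dst (G : MultiDigraph V E) (d : Dart E) : V := if d.2 then G.head d.1 else G.tail d.1

/-- The underlying undirected simple graph (used only to count connected components). -/
def underlying (G : MultiDigraph V E) : SimpleGraph V :=
  SimpleGraph.fromRel fun v w => ∃ e, G.tail e = v ∧ G.head e = w

end MultiDigraph

/-- A (combinatorial) embedding on the sphere, with face set `H`, of a finite directed multigraph
that need not be connected.

* `rot d` is the next dart after `d` in counterclockwise order around the vertex `d` emanates from;
* `left d` is the face on the left-hand side of `d`. It is the face in the corner between `d` and
  `rot d`, so it lies on the right-hand side of `rot d`, which is `left_rev_rot`. A face may have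
  several boundary walks, as happens if the graph is disconnected;
* `isolatedFace v` is the face which contains the isolated vertex `v`;
* `connected` says that the surface made up of the vertices, arcs and faces is connected, and
  `euler` is Euler's formula `|V| - |E| + |H| = 1 + #components`. Together they say that this
  surface is the sphere. -/
structure PlaneEmbedding {V E : Type*} [Fintype V] [Fintype E] (G : MultiDigraph V E)
    (H : Type*) [Fintype H] where
  rot : Equiv.Perm (Dart E)
  rot_sameCycle : ∀ d d', rot.SameCycle d d' ↔ G.src d = G.src d'
  left : Dart E → H
  left_rev_rot : ∀ d, left (rot d).rev = left d
  isolatedFace : {v : V // ∀ d, G.src d ≠ v} → H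
  connected : (SimpleGraph.fromRel fun x y : V ⊕ H =>
    (∃ d, x = Sum.inl (G.src d) ∧ y = Sum.inr (left d)) ∨
    (∃ v, x = Sum.inl v.1 ∧ y = Sum.inr (isolatedFace v))).Connected
  euler : Fintype.card V + Fintype.card H =
    Fintype.card E + 1 + Nat.card G.underlying.ConnectedComponent

/-- A finite directed multigraph is planar if it has an embedding on the sphere. -/
def IsPlanar {V E : Type*} [Fintype V] [Fintype E] (G : MultiDigraph V E) : Prop :=
  ∃ k : ℕ, Nonempty (PlaneEmbedding G (Fin k))

namespace PlaneEmbedding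

variable {V E H : Type*} [Fintype V] [Fintype E] [Fintype H] {G : MultiDigraph V E}

/-- The face on the right-hand side of a dart. -/
def right (P : PlaneEmbedding G H) (d : Dart E) : H := P.left d.rev

/-- The (geometric) dual graph: the dual arc of `e` goes from the face on the left-hand side of
`e` to the face on its right-hand side. -/
def dualGraph (P : PlaneEmbedding G H) : MultiDigraph H E where
  tail e := P.left (e, true)
  head e := P.right (e, true)

end PlaneEmbedding

/-! ### Optimisation problems -/

/-- A minimisation problem over `X`. -/
@[ext] structure MinProblem (X : Type*) where
  feasible : Set X
  objective : X → ℝ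

namespace MinProblem

variable {X : Type*}

/-- `x` is an optimal solution. -/
def IsOptimal (p : MinProblem X) (x : X) : Prop :=
  x ∈ p.feasible ∧ ∀ y ∈ p.feasible, p.objective x ≤ p.objective y

/-- The optimal value: `⊤` if the problem is infeasible, `⊥` if it is unbounded. -/
noncomputable def value (p : MinProblem X) : EReal :=
  ⨅ x ∈ p.feasible, (p.objective x : EReal)

end MinProblem

/-- The linear program: maximise `c ⬝ᵥ x` subject to `A *ᵥ x ≤ b` (with `x` free). -/
structure LinearProgram (I J : Type*) where
  A : Matrix I J ℝ
  b : I → ℝ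
  c : J → ℝ

/-- The linear programming dual: minimise `b ⬝ᵥ y` subject to `Aᵀ y = c` and `y ≥ 0`. -/
def LinearProgram.dual {I J : Type*} [Fintype I] (L : LinearProgram I J) :
    MinProblem (I → ℝ) where
  feasible := {y | Matrix.mulVec L.A.transpose y = L.c ∧ ∀ i, 0 ≤ y i}
  objective y := dotProduct L.b y

/-! ### Flow networks -/

/-- A flow network: costs, capacities (possibly `∞`), lower bounds and balances. -/
structure FlowNetwork (V E : Type*) [Fintype V] extends MultiDigraph V E where
  cost : E → ℝ
  cap : E → WithTop ℝ
  lower : E → ℝ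
  balance : V → ℝ
  lower_nonneg : ∀ e, 0 ≤ lower e
  lower_le_cap : ∀ e, (lower e : WithTop ℝ) ≤ cap e
  sum_balance : ∑ v, balance v = 0

namespace FlowNetwork

variable {V E H : Type*} [Fintype V] [Fintype E] [Fintype H]

/-- The min-cost flow problem. -/
def minCostFlow [DecidableEq V] (N : FlowNetwork V E) : MinProblem (E → ℝ) where
  feasible := {f |
    (∀ v, ∑ e with N.tail e = v, f e - ∑ e with N.head e = v, f e = N.balance v) ∧
    ∀ e, N.lower e ≤ f e ∧ (f e : WithTop ℝ) ≤ N.cap e}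
  objective f := ∑ e, N.cost e * f e

/-- The min-cost flow problem of `N` is a min-cost circulation problem. -/
def IsCirculation (N : FlowNetwork V E) : Prop := ∀ v, N.balance v = 0

/-- The min-cost flow problem of `N` is a min-cost transshipment problem. -/
def IsTransshipment (N : FlowNetwork V E) : Prop := ∀ e, N.lower e = 0 ∧ N.cap e = ⊤

/-- The capacity of a dart: `u(e)` for the forward dart and `-ℓ(e)` for the backward dart of `e`. -/
def dartCap (N : FlowNetwork V E) (d : Dart E) : WithTop ℝ :=
  if d.2 then N.cap d.1 else ((-N.lower d.1 : ℝ) : WithTop ℝ)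

/-- The cost of sending one unit of flow clockwise around the face `h`. -/
def faceCost [DecidableEq H] (N : FlowNetwork V E) (P : PlaneEmbedding N.toMultiDigraph H)
    (h : H) : ℝ :=
  ∑ e with P.right (e, true) = h, N.cost e - ∑ e with P.left (e, true) = h, N.cost e

theorem sum_faceCost [DecidableEq H] (N : FlowNetwork V E)
    (P : PlaneEmbedding N.toMultiDigraph H) : ∑ h, N.faceCost P h = 0 := by
  simp only [faceCost, Finset.sum_sub_distrib]
  rw [Finset.sum_fiberwise, Finset.sum_fiberwise, sub_self]

/-- The circulation which sends `π h` units of flow clockwise around every face `h`. -/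
def faceFlow (N : FlowNetwork V E) (P : PlaneEmbedding N.toMultiDigraph H) (π : H → ℝ) : E → ℝ :=
  fun e => π (P.right (e, true)) - π (P.left (e, true))

/-- The geometric dual formulation: minimise `∑ c(h) π(h)` subject to `π(h) - π(g) ≤ u(d)` for
every dual dart `d = (g, h)`. There is no constraint if `u(d) = ∞`. -/
def potentialProblem [DecidableEq H] (N : FlowNetwork V E)
    (P : PlaneEmbedding N.toMultiDigraph H) : MinProblem (H → ℝ) where
  feasible := {π | ∀ d : Dart E,
    ((π (P.dualGraph.dst d) - π (P.dualGraph.src d) : ℝ) : WithTop ℝ) ≤ N.dartCap d}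
  objective π := ∑ h, N.faceCost P h * π h

/-- The arcs of the network `G^lpd`: the capacitated darts. -/
abbrev LpdArc (N : FlowNetwork V E) := {d : Dart E // N.dartCap d ≠ ⊤}

/-- The (finite) capacity of a capacitated dart. -/
def lpdCost (N : FlowNetwork V E) (a : N.LpdArc) : ℝ := (N.dartCap a.1).untop a.2

/-- The geometric dual formulation as a maximisation problem: maximise `∑ -c(h) π(h)` subject to
`π(h) - π(g) ≤ u(d)` for every capacitated dual dart `d = (g, h)`. -/
def potentialLP [DecidableEq H] (N : FlowNetwork V E)
    (P : PlaneEmbedding N.toMultiDigraph H) : LinearProgram N.LpdArc H where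
  A := Matrix.of fun a h =>
    (if P.dualGraph.dst a.1 = h then 1 else 0) - (if P.dualGraph.src a.1 = h then 1 else 0)
  b := N.lpdCost
  c h := -N.faceCost P h

/-- The network `G^lpd` on the face set: an uncapacitated arc `(g, h)` of cost `u(d)` for every
capacitated dual dart `d = (g, h)`, and balance `c(h)` at the face `h`. -/
def lpd [DecidableEq H] (N : FlowNetwork V E) (P : PlaneEmbedding N.toMultiDigraph H) :
    FlowNetwork H N.LpdArc where
  tail a := P.dualGraph.src a.1
  head a := P.dualGraph.dst a.1
  cost := N.lpdCost
  cap _ := ⊤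
  lower _ := 0
  balance := N.faceCost P
  lower_nonneg _ := le_rfl
  lower_le_cap _ := le_top
  sum_balance := N.sum_faceCost P

end FlowNetwork

end PlanarDuality

/-! Sending `π h` units clockwise around every face is a linear map from face functions to
circulations. Its kernel consists of constants, because vertices, arcs and faces make up a connected
surface. By rank-nullity for the incidence matrix, the circulations have dimension |E| - |V| +
#components, which is |H| - 1 by Euler's formula. So the map is onto (`exists_faceFlow_eq`), and (C)
and (P) are one problem in two coordinate systems. The constraint matrix of (P) is, up to sign and
transposition, the incidence matrix of `G^lpd`, so its linear programming dual is (D). Values,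
existence of optima and the slackness criterion follow from strong duality, obtained here from
Farkas' lemma.

Planarity of `G^lpd` is a matter of counting orbits of rotations. Orbits are counted by the
dimension of the space of invariant functions, so inequalities come from injective linear maps. If
`G` is disconnected, a face can have several boundary walks, and these walks give a rotation on the
dual with several cycles at one dual vertex. It satisfies an Euler-type inequality
(`orbitCount_dualRot_le`). The inequality survives the doubling of arcs, since every doubled arc
adds a face (`card_le_orbitCount_rev_mul_doubleRot`), and the merging of cycles, since a merger
costs at most one face (`exists_merge`). Once every vertex has a single cycle, it says |V| - |E| +
|F| ≥ 2; nonnegativity of the genus (`orbitCount_add_card_le`) gives the reverse, hence a sphere. -/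

namespace PlanarDuality

/-! ### Linear programming duality -/

/-- Farkas' lemma for finitely many linear functionals on an arbitrary real vector space. -/
theorem exists_nonneg_combination {I W : Type*} [AddCommGroup W] [Module ℝ W] (s : Finset I) :
    ∀ (a : I → W →ₗ[ℝ] ℝ) (γ : W →ₗ[ℝ] ℝ),
      (∀ x, (∀ i ∈ s, a i x ≤ 0) → γ x ≤ 0) →
      ∃ y : I → ℝ, (∀ i, 0 ≤ y i) ∧ γ = ∑ i ∈ s, y i • a i := by
  classical
  induction s using Finset.induction_on with
  | empty =>
    intro a γ h
    refine ⟨0, fun _ => le_rfl, LinearMap.ext fun x => ?_⟩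
    have h1 := h x (by simp)
    have h2 := h (-x) (by simp)
    rw [map_neg] at h2
    simp only [Finset.sum_empty, LinearMap.zero_apply]
    linarith
  | insert j s hj ih =>
    intro a γ h
    by_cases h0 : ∀ x, (∀ i ∈ s, a i x ≤ 0) → γ x ≤ 0
    · obtain ⟨y, hy, rfl⟩ := ih a γ h0
      refine ⟨Function.update y j 0, fun i => ?_, ?_⟩
      · by_cases hi : i = j
        · subst hi; simp
        · simp [hi, hy]
      · rw [Finset.sum_insert hj, Function.update_self, zero_smul, zero_add]
        refine Finset.sum_congr rfl fun i hi => ?_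
        rw [Function.update_of_ne (ne_of_mem_of_not_mem hi hj)]
    · push Not at h0
      obtain ⟨x₀, hx₀, hγ⟩ := h0
      have hpos : 0 < a j x₀ := by
        by_contra hle
        refine absurd (h x₀ fun i hi => ?_) (not_le.2 hγ)
        rcases Finset.mem_insert.1 hi with rfl | hi
        · exact not_lt.1 hle
        · exact hx₀ i hi
      -- These are `a i` and `γ` composed with the projection along `x₀` onto the kernel of `a j`,
      -- which removes the constraint `j`.
      obtain ⟨y, hy, he⟩ := ih (fun i => a i - (a i x₀ / a j x₀) • a j)
        (γ - (γ x₀ / a j x₀) • a j) fun x hx => by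
          have := h (x - (a j x / a j x₀) • x₀) fun i hi => by
            rcases Finset.mem_insert.1 hi with rfl | hi
            · simp [hpos.ne']
            · have := hx i hi
              simp only [LinearMap.sub_apply, LinearMap.smul_apply, smul_eq_mul, map_sub,
                map_smul] at this ⊢
              convert this using 1
              ring
          simp only [LinearMap.sub_apply, LinearMap.smul_apply, smul_eq_mul, map_sub,
            map_smul] at this ⊢
          convert this using 1
          ring
      -- The coefficient of `a j` is forced by evaluating at `x₀`; it is nonnegative because `γ x₀ >
      -- 0` and `a i x₀ ≤ 0` on `s`.
      refine ⟨Function.update y j (γ x₀ / a j x₀ - ∑ i ∈ s, y i * (a i x₀ / a j x₀)),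
        fun i => ?_, ?_⟩
      · by_cases hi : i = j
        · subst hi
          rw [Function.update_self, sub_nonneg]
          refine le_trans (Finset.sum_nonpos fun k hk => ?_) (div_pos hγ hpos).le
          exact mul_nonpos_of_nonneg_of_nonpos (hy k)
            (div_nonpos_of_nonpos_of_nonneg (hx₀ k hk) hpos.le)
        · rw [Function.update_of_ne hi]
          exact hy i
      · rw [Finset.sum_insert hj, Function.update_self]
        have hs : ∑ i ∈ s, Function.update y j
            (γ x₀ / a j x₀ - ∑ i ∈ s, y i * (a i x₀ / a j x₀)) i • a i = ∑ i ∈ s, y i • a i :=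
          Finset.sum_congr rfl fun i hi => by
            rw [Function.update_of_ne (ne_of_mem_of_not_mem hi hj)]
        rw [hs]
        refine LinearMap.ext fun x => ?_
        have := LinearMap.congr_fun he x
        simp only [LinearMap.sub_apply, LinearMap.smul_apply, smul_eq_mul, LinearMap.sum_apply,
          LinearMap.add_apply, mul_sub, Finset.sum_sub_distrib, sub_mul, Finset.sum_mul] at this ⊢
        simp only [← mul_assoc] at this ⊢
        linarith

namespace LinearProgram

variable {I J : Type*} [Fintype I] [Fintype J] (L : LinearProgram I J)

/-- The feasible points of a linear program. -/
def feasible : Set (J → ℝ) := {x | ∀ i, Matrix.mulVec L.A x i ≤ L.b i}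

theorem dotProduct_eq_of_mem_dual {y : I → ℝ} (hy : y ∈ L.dual.feasible) (x : J → ℝ) :
    dotProduct L.c x = dotProduct y (Matrix.mulVec L.A x) := by
  rw [← hy.1, Matrix.mulVec_transpose, Matrix.dotProduct_mulVec]

/-- The duality gap of a pair of a primal and a dual point. -/
theorem objective_sub_eq_sum {y : I → ℝ} (hy : y ∈ L.dual.feasible) (x : J → ℝ) :
    L.dual.objective y - dotProduct L.c x = ∑ i, y i * (L.b i - Matrix.mulVec L.A x i) := by
  rw [L.dotProduct_eq_of_mem_dual hy]
  simp only [dual, dotProduct, mul_sub, Finset.sum_sub_distrib, mul_comm]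

theorem weak_duality {x : J → ℝ} (hx : x ∈ L.feasible) {y : I → ℝ} (hy : y ∈ L.dual.feasible) :
    dotProduct L.c x ≤ L.dual.objective y := by
  rw [← sub_nonneg, L.objective_sub_eq_sum hy]
  exact Finset.sum_nonneg fun i _ => mul_nonneg (hy.2 i) (sub_nonneg.2 (hx i))

/-- An upper bound on the values of a feasible linear program is attained by the dual. -/
theorem exists_dual_le {β : ℝ} (hne : L.feasible.Nonempty)
    (hβ : ∀ x ∈ L.feasible, dotProduct L.c x ≤ β) :
    ∃ y ∈ L.dual.feasible, L.dual.objective y ≤ β := by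
  classical
  obtain ⟨x₀, hx₀⟩ := hne
  -- Homogenisation: with an extra coordinate `s ≥ 0`, the constraints become `A x ≤ s b` and the
  -- bound becomes `c x ≤ s β`, to which Farkas' lemma applies.
  let fst := LinearMap.fst ℝ (J → ℝ) ℝ
  let snd := LinearMap.snd ℝ (J → ℝ) ℝ
  let a : Option I → (J → ℝ) × ℝ →ₗ[ℝ] ℝ := fun o => o.elim (-snd) fun i =>
    (LinearMap.proj i ∘ₗ L.A.mulVecLin) ∘ₗ fst - L.b i • snd
  let γ : (J → ℝ) × ℝ →ₗ[ℝ] ℝ := dotProductBilin ℝ ℝ L.c ∘ₗ fst - β • snd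
  have hγ : ∀ x s, γ (x, s) = dotProduct L.c x - β * s := fun x s => rfl
  have ha : ∀ i x s, a (some i) (x, s) = Matrix.mulVec L.A x i - L.b i * s := fun i x s => rfl
  have ha0 : ∀ x s, a none (x, s) = -s := fun x s => rfl
  obtain ⟨y, hy, he⟩ := exists_nonneg_combination Finset.univ a γ fun ⟨x, s⟩ h => by
    have h1 : ∀ i, Matrix.mulVec L.A x i ≤ L.b i * s := fun i => by
      have := h (some i) (Finset.mem_univ _)
      rw [ha] at this
      linarith
    have h0 : 0 ≤ s := by
      have := h none (Finset.mem_univ _)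
      rw [ha0] at this
      linarith
    rw [hγ, sub_nonpos]
    rcases h0.eq_or_lt with rfl | hs
    · by_contra! hc
      simp only [mul_zero] at h1 hc
      -- At `s = 0`, `x` is a recession direction. If it improved the objective, this step length
      -- from `x₀` would push the value past `β`.
      have := hβ (x₀ + ((|β - dotProduct L.c x₀| + 1) / dotProduct L.c x) • x) fun i => by
        rw [Matrix.mulVec_add, Matrix.mulVec_smul]
        have h2 : (|β - dotProduct L.c x₀| + 1) / dotProduct L.c x * Matrix.mulVec L.A x i ≤ 0 :=
          mul_nonpos_of_nonneg_of_nonpos (by positivity) (h1 i)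
        have := hx₀ i
        simp only [Pi.add_apply, Pi.smul_apply, smul_eq_mul]
        linarith
      rw [dotProduct_add, dotProduct_smul, smul_eq_mul, div_mul_cancel₀ _ hc.ne'] at this
      have := le_abs_self (β - dotProduct L.c x₀)
      linarith
    · have := hβ (s⁻¹ • x) fun i => by
        rw [Matrix.mulVec_smul, Pi.smul_apply, smul_eq_mul, inv_mul_le_iff₀ hs, mul_comm]
        exact h1 i
      rwa [dotProduct_smul, smul_eq_mul, inv_mul_le_iff₀ hs, mul_comm] at this
  have he' : ∀ x s, dotProduct L.c x - β * s =
      -(y none * s) + ∑ i, y (some i) * (Matrix.mulVec L.A x i - L.b i * s) := fun x s => by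
    have := LinearMap.congr_fun he (x, s)
    rw [hγ, LinearMap.sum_apply, Fintype.sum_option] at this
    simpa [ha, ha0] using this
  -- Evaluation at `(e_j, 0)` yields the dual equations; evaluation at `(0, 1)` yields `b ⬝ y = β -
  -- y none ≤ β`.
  refine ⟨fun i => y (some i), ⟨?_, fun i => hy _⟩, ?_⟩
  · ext j
    have := he' (Pi.single j 1) 0
    simp only [dotProduct_single, Matrix.mulVec_single, mul_one, mul_zero, sub_zero, neg_zero,
      zero_add] at this
    rw [this]
    simp [Matrix.mulVec, dotProduct, mul_comm]
  · have := he' 0 1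
    simp only [dotProduct_zero, Matrix.mulVec_zero, mul_one, Pi.zero_apply, zero_sub, mul_neg,
      Finset.sum_neg_distrib] at this
    have h0 := hy none
    simp only [dual, dotProduct, mul_comm (L.b _)]
    linarith

/-- A lower bound on the values of a feasible dual is attained by the linear program. -/
theorem exists_le_dotProduct {β : ℝ} (hne : L.dual.feasible.Nonempty)
    (hβ : ∀ y ∈ L.dual.feasible, β ≤ L.dual.objective y) :
    ∃ x ∈ L.feasible, β ≤ dotProduct L.c x := by
  classical
  -- The dual in primal form: `-y ≤ 0`, `Aᵀ y ≤ c`, `-Aᵀ y ≤ -c`, maximising `-b ⬝ y`. A dual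
  -- solution of `M` then splits into a slack and two nonnegative parts, whose difference is the
  -- wanted `x`.
  let M : LinearProgram (I ⊕ J ⊕ J) I :=
    { A := Matrix.of (Sum.elim (-1 : Matrix I I ℝ) (Sum.elim L.A.transpose (-L.A.transpose)))
      b := Sum.elim 0 (Sum.elim L.c (-L.c))
      c := -L.b }
  have hA : ∀ y, Matrix.mulVec M.A y =
      Sum.elim (-y) (Sum.elim (Matrix.mulVec L.A.transpose y)
        (-Matrix.mulVec L.A.transpose y)) := fun y => by
    ext (i | j | j)
    · change dotProduct ((-1 : Matrix I I ℝ) i) y = -y i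
      change Matrix.mulVec (-1 : Matrix I I ℝ) y i = -y i
      simp [Matrix.neg_mulVec]
    · rfl
    · change Matrix.mulVec (-L.A.transpose) y j = _
      simp [Matrix.neg_mulVec]
  have hM : M.feasible = L.dual.feasible := by
    ext y
    simp only [feasible, dual, Set.mem_ofPred_eq, hA, Sum.forall, Sum.elim_inl, Sum.elim_inr, M,
      Pi.neg_apply, Pi.zero_apply, neg_nonpos, neg_le_neg_iff, funext_iff]
    constructor
    · rintro ⟨h, h1, h2⟩
      exact ⟨fun j => le_antisymm (h1 j) (h2 j), h⟩
    · rintro ⟨h, h1⟩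
      exact ⟨h1, fun j => (h j).le, fun j => (h j).ge⟩
  obtain ⟨w, ⟨hw, hw0⟩, hwβ⟩ := M.exists_dual_le (β := -β) (hM ▸ hne) fun y hy => by
    have := hβ y (hM ▸ hy)
    simp only [dual] at this
    simpa [M, neg_dotProduct] using this
  have hw' : ∀ i, -w (Sum.inl i) + (Matrix.mulVec L.A (fun j => w (Sum.inr (Sum.inl j))) i
      - Matrix.mulVec L.A (fun j => w (Sum.inr (Sum.inr j))) i) = -L.b i := fun i => by
    have := congrFun hw i
    have h1 : ∀ k, M.A (Sum.inl k) i = -(1 : Matrix I I ℝ) k i := fun k => rfl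
    have h2 : ∀ j, M.A (Sum.inr (Sum.inl j)) i = L.A i j := fun j => rfl
    have h3 : ∀ j, M.A (Sum.inr (Sum.inr j)) i = -L.A i j := fun j => rfl
    have h4 : M.c i = -L.b i := rfl
    simp only [Matrix.mulVec, dotProduct, Matrix.transpose_apply, Fintype.sum_sum_type, h1, h2, h3,
      h4, Matrix.one_apply, neg_mul, Finset.sum_neg_distrib, ite_mul, one_mul, zero_mul,
      Finset.sum_ite_eq', Finset.mem_univ, if_true] at this ⊢
    linarith
  refine ⟨(fun j => w (Sum.inr (Sum.inr j))) - fun j => w (Sum.inr (Sum.inl j)), fun i => ?_, ?_⟩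
  · rw [Matrix.mulVec_sub, Pi.sub_apply]
    have := hw' i
    have := hw0 (Sum.inl i)
    linarith
  · simp only [dual, M, dotProduct, Fintype.sum_sum_type, Sum.elim_inl, Sum.elim_inr,
      Pi.zero_apply, zero_mul, Finset.sum_const_zero, zero_add, Pi.neg_apply, neg_mul,
      Finset.sum_neg_distrib] at hwβ
    simp only [dotProduct, Pi.sub_apply, mul_sub, Finset.sum_sub_distrib]
    linarith

/-- Strong duality: if both programs are feasible, both have optimal solutions of equal value. -/
theorem strong_duality (hP : L.feasible.Nonempty) (hD : L.dual.feasible.Nonempty) :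
    ∃ x ∈ L.feasible, ∃ y ∈ L.dual.feasible, dotProduct L.c x = L.dual.objective y := by
  obtain ⟨y₀, hy₀⟩ := hD
  have hbdd : BddAbove ((fun x => dotProduct L.c x) '' L.feasible) :=
    ⟨L.dual.objective y₀, by rintro _ ⟨x, hx, rfl⟩; exact L.weak_duality hx hy₀⟩
  -- Both attainment lemmas are used with `β` the primal supremum, which is also a lower bound for
  -- the dual.
  obtain ⟨y, hy, hyβ⟩ := L.exists_dual_le hP fun x hx =>
    le_csSup hbdd (Set.mem_image_of_mem _ hx)
  obtain ⟨x, hx, hxβ⟩ := L.exists_le_dotProduct ⟨y₀, hy₀⟩ fun z hz =>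
    csSup_le (hP.image _) (by rintro _ ⟨x, hx, rfl⟩; exact L.weak_duality hx hz)
  exact ⟨x, hx, y, hy, le_antisymm (L.weak_duality hx hy) (hyβ.trans hxβ)⟩

end LinearProgram

/-! ### Counting the orbits of a permutation -/

open Equiv

section Orbits

variable {D : Type*}

/-- The real functions that are invariant under a permutation. -/
def invariants (ρ : Perm D) : Submodule ℝ (D → ℝ) where
  carrier := {f | ∀ x, f (ρ x) = f x}
  add_mem' := fun ha hb x => by simp [ha x, hb x]
  zero_mem' := fun x => rfl
  smul_mem' := fun c f hf x => by simp [hf x]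

/-- The number of orbits of a permutation, as the dimension of its space of invariants. -/
noncomputable def orbitCount (ρ : Perm D) : ℕ := Module.finrank ℝ (invariants ρ)

theorem eq_of_sameCycle {T : Type*} {ρ : Perm D} {f : D → T} (hf : ∀ x, f (ρ x) = f x) {x y : D}
    (h : ρ.SameCycle x y) : f x = f y := by
  obtain ⟨n, rfl⟩ := h
  have hn : ∀ (n : ℕ) x, f ((ρ ^ n) x) = f x := fun n => by
    induction n with
    | zero => intro x; rfl
    | succ n ih => intro x; rw [pow_succ, Perm.mul_apply, ih, hf]
  cases n with
  | ofNat n => exact (hn n x).symm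
  | negSucc n =>
    rw [zpow_negSucc, ← hn (n + 1) ((ρ ^ (n + 1))⁻¹ x), ← Perm.mul_apply, mul_inv_cancel, Perm.one_apply]

theorem orbitCount_inv (ρ : Perm D) : orbitCount ρ⁻¹ = orbitCount ρ := by
  have : invariants ρ⁻¹ = invariants ρ := by
    ext f
    refine ⟨fun h x => ?_, fun h x => ?_⟩
    · rw [← h (ρ x), ← Perm.mul_apply, inv_mul_cancel, Perm.one_apply]
    · rw [← h (ρ⁻¹ x), ← Perm.mul_apply, mul_inv_cancel, Perm.one_apply]
  rw [orbitCount, this, orbitCount]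

/-- An invariant surjection bounds the number of orbits from below. -/
theorem card_le_orbitCount [Finite D] {Q : Type*} [Fintype Q] {ρ : Perm D} {q : D → Q}
    (hq : Function.Surjective q) (h : ∀ x, q (ρ x) = q x) : Fintype.card Q ≤ orbitCount ρ := by
  rw [← Module.finrank_fintype_fun_eq_card ℝ]
  refine LinearMap.finrank_le_finrank_of_injective
    (f := (LinearMap.funLeft ℝ ℝ q).codRestrict (invariants ρ)
      fun f x => by simp [LinearMap.funLeft_apply, h]) fun f g hfg => ?_
  exact LinearMap.funLeft_injective_of_surjective ℝ ℝ q hq (congrArg Subtype.val hfg)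

theorem orbitCount_le_card {Q : Type*} [Fintype Q] {ρ : Perm D} (q : Q → D)
    (h : ∀ x, ∃ i, ρ.SameCycle (q i) x) : orbitCount ρ ≤ Fintype.card Q := by
  rw [← Module.finrank_fintype_fun_eq_card ℝ]
  refine LinearMap.finrank_le_finrank_of_injective
    (f := LinearMap.funLeft ℝ ℝ q ∘ₗ (invariants ρ).subtype) fun f g hfg => ?_
  ext x
  obtain ⟨i, hi⟩ := h x
  rw [← eq_of_sameCycle f.2 hi, ← eq_of_sameCycle g.2 hi]
  exact congrFun hfg i

variable [Finite D]

/-- The orbits of a permutation can be numbered. -/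
theorem exists_orbit_labelling (ρ : Perm D) : ∃ q : D → Fin (orbitCount ρ),
    Function.Surjective q ∧ ∀ x, q (ρ x) = q x := by
  classical
  have := Fintype.ofFinite (Quotient (Perm.SameCycle.setoid ρ))
  have hmk : ∀ x, (Quotient.mk (Perm.SameCycle.setoid ρ) (ρ x)) = Quotient.mk _ x :=
    fun x => Quotient.sound (show ρ.SameCycle (ρ x) x from Perm.sameCycle_apply_left.2 .rfl)
  have hcard : Fintype.card (Quotient (Perm.SameCycle.setoid ρ)) = orbitCount ρ :=
    le_antisymm (card_le_orbitCount Quotient.mk_surjective hmk)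
      (orbitCount_le_card Quotient.out fun x => ⟨Quotient.mk _ x, Quotient.mk_out
        (s := Perm.SameCycle.setoid ρ) x⟩)
  let e := Fintype.equivFinOfCardEq hcard
  exact ⟨fun x => e (Quotient.mk _ x), e.surjective.comp Quotient.mk_surjective,
    fun x => congrArg e (hmk x)⟩

variable [DecidableEq D]

/-- A `ρ`-invariant function with equal values at `x` and `y` is also invariant under `ρ * swap x
y`, and this is a single linear condition. -/
theorem orbitCount_le_mul_swap (ρ : Perm D) (x y : D) :
    orbitCount ρ ≤ orbitCount (ρ * swap x y) + 1 := by
  let l : invariants ρ →ₗ[ℝ] ℝ :=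
    (LinearMap.proj x - LinearMap.proj (R := ℝ) (φ := fun _ : D => ℝ) y) ∘ₗ (invariants ρ).subtype
  have h1 := l.finrank_range_add_finrank_ker
  have h2 : Module.finrank ℝ l.range ≤ 1 := by
    simpa using Submodule.finrank_le l.range
  have hl : ∀ f : l.ker, f.1.1 x = f.1.1 y := fun f => sub_eq_zero.1 f.2
  have h3 : Module.finrank ℝ l.ker ≤ orbitCount (ρ * swap x y) := by
    refine LinearMap.finrank_le_finrank_of_injective
      (f := ((invariants ρ).subtype ∘ₗ l.ker.subtype).codRestrict (invariants (ρ * swap x y))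
        fun f z => ?_) fun f g hfg => ?_
    · change f.1.1 (ρ (swap x y z)) = f.1.1 z
      rw [f.1.2]
      rcases eq_or_ne z x with rfl | hx
      · rw [swap_apply_left, hl]
      · rcases eq_or_ne z y with rfl | hy
        · rw [swap_apply_right, hl]
        · rw [swap_apply_of_ne_of_ne hx hy]
    · have hfg : f.1.1 = g.1.1 := congrArg (fun g : invariants (ρ * swap x y) => g.1) hfg
      exact Subtype.ext (Subtype.ext hfg)
  rw [orbitCount]
  omega

/-- The swap joins two cycles into one, so fewer functions remain invariant; the indicator of the
old cycle of `x` is lost. -/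
theorem orbitCount_mul_swap_lt {ρ : Perm D} {x y : D} (h : ¬ ρ.SameCycle x y) :
    orbitCount (ρ * swap x y) < orbitCount ρ := by
  classical
  refine Submodule.finrank_lt_finrank_of_lt (lt_of_le_of_ne (fun f hf => ?_) fun he => ?_)
  · have hx : f (ρ y) = f x := by simpa using hf x
    have hy : f (ρ x) = f y := by simpa using hf y
    have hz : ∀ z, z ≠ x → z ≠ y → f (ρ z) = f z := fun z h1 h2 => by
      simpa [swap_apply_of_ne_of_ne h1 h2] using hf z
    -- Walk along the `ρ`-cycle from `ρ x`: it never meets `y`, so `f` is unchanged until the walk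
    -- returns to `x`, at the latest after `orderOf ρ` steps.
    have key : ∀ n : ℕ, f (ρ x) = f x ∨ f ((ρ ^ (n + 1)) x) = f (ρ x) := fun n => by
      induction n with
      | zero => right; simp
      | succ n ih =>
        rcases ih with ih | ih
        · exact Or.inl ih
        by_cases h1 : (ρ ^ (n + 1)) x = x
        · left; rw [← ih, h1]
        · right
          rw [pow_succ', Perm.mul_apply, hz _ h1 fun h2 => h ⟨(n + 1 : ℕ), by exact_mod_cast h2⟩, ih]
    have hxx : f (ρ x) = f x := by
      rcases key (orderOf ρ - 1) with h1 | h1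
      · exact h1
      · rw [Nat.sub_add_cancel (orderOf_pos ρ), pow_orderOf_eq_one] at h1
        exact h1.symm
    intro z
    by_cases h1 : z = x
    · rw [h1, hxx]
    by_cases h2 : z = y
    · rw [h2, hx, ← hxx, hy]
    exact hz z h1 h2
  · have hmem : (fun z => if ρ.SameCycle x z then (1 : ℝ) else 0) ∈ invariants ρ := fun z => by
      simp [Perm.sameCycle_apply_right]
    rw [← he] at hmem
    have := hmem x
    simp only [Perm.mul_apply, swap_apply_left, Perm.sameCycle_apply_right, h, if_false,
      Perm.SameCycle.rfl, if_true] at this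
    exact zero_ne_one this

/-- The cycles of a permutation `ρ` which preserves the fibres of `f` can be merged until they are
the fibres of `f`; every merger lowers the number of orbits of `α * ρ` by at most one. -/
theorem exists_merge {T : Type*} (f : D → T) (α : Perm D) (n : ℕ) :
    ∀ ρ : Perm D, orbitCount ρ ≤ n → (∀ x, f (ρ x) = f x) →
      ∃ ρ' : Perm D, (∀ x y, ρ'.SameCycle x y ↔ f x = f y) ∧
        orbitCount (α * ρ) + orbitCount ρ' ≤ orbitCount (α * ρ') + orbitCount ρ := by
  induction n with
  | zero =>
    intro ρ hn hf
    refine ⟨ρ, fun x y => ⟨eq_of_sameCycle hf, fun _ => ?_⟩, le_rfl⟩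
    by_contra h
    have := orbitCount_mul_swap_lt h
    omega
  | succ n ih =>
    intro ρ hn hf
    by_cases h : ∀ x y, f x = f y → ρ.SameCycle x y
    · exact ⟨ρ, fun x y => ⟨eq_of_sameCycle hf, h x y⟩, le_rfl⟩
    · push Not at h
      obtain ⟨x, y, hxy, h⟩ := h
      have h1 := orbitCount_mul_swap_lt h
      have h2 := orbitCount_le_mul_swap (α * ρ) x y
      obtain ⟨ρ', hρ', h3⟩ := ih (ρ * swap x y) (by omega) fun z => by
        rw [Perm.mul_apply, hf]
        rcases eq_or_ne z x with rfl | hx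
        · rw [swap_apply_left, hxy]
        · rcases eq_or_ne z y with rfl | hy
          · rw [swap_apply_right, hxy]
          · rw [swap_apply_of_ne_of_ne hx hy]
      rw [← mul_assoc] at h3
      exact ⟨ρ', hρ', by omega⟩

end Orbits

/-! ### Circulations and face functions -/

/-- The permutation of the darts that reverses every dart. -/
def revPerm (E : Type*) : Perm (Dart E) where
  toFun := Dart.rev
  invFun := Dart.rev
  left_inv d := by simp [Dart.rev]
  right_inv d := by simp [Dart.rev]

@[simp] theorem revPerm_apply {E : Type*} (d : Dart E) : revPerm E d = d.rev := rfl

@[simp] theorem Dart.rev_rev {E : Type*} (d : Dart E) : d.rev.rev = d := by simp [Dart.rev]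

theorem fromRel_eq_of_connected {V T : Type*} {r : V → V → Prop}
    (hc : (SimpleGraph.fromRel r).Preconnected) {f : V → T} (hf : ∀ x y, r x y → f x = f y)
    (x y : V) : f x = f y := by
  obtain ⟨w⟩ := hc x y
  induction w with
  | nil => rfl
  | cons h _ ih =>
    rw [← ih]
    rcases ((SimpleGraph.fromRel_adj _ _ _).1 h).2 with h | h
    · exact hf _ _ h
    · exact (hf _ _ h).symm

namespace MultiDigraph

variable {V E : Type*} (G : MultiDigraph V E)

@[simp] theorem src_rev (d : Dart E) : G.src d.rev = G.dst d := by
  obtain ⟨e, b⟩ := d; cases b <;> rfl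

/-- The potentials that are constant on the connected components. -/
def constants : Submodule ℝ (V → ℝ) where
  carrier := {p | ∀ e, p (G.head e) = p (G.tail e)}
  add_mem' := fun ha hb e => by simp [ha e, hb e]
  zero_mem' := fun e => rfl
  smul_mem' := fun c f hf e => by simp [hf e]

theorem connectedComponentMk_head (e : E) :
    G.underlying.connectedComponentMk (G.head e) = G.underlying.connectedComponentMk (G.tail e) := by
  by_cases h : G.head e = G.tail e
  · rw [h]
  · exact SimpleGraph.ConnectedComponent.sound
      (SimpleGraph.Adj.reachable ((SimpleGraph.fromRel_adj _ _ _).2 ⟨h, Or.inr ⟨e, rfl, rfl⟩⟩))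

/-- The codomain is arbitrary so that predicates, and components of another graph, can serve as `p`.
-/
theorem eq_of_reachable {T : Type*} {p : V → T} (hp : ∀ e, p (G.head e) = p (G.tail e)) {v w : V}
    (h : G.underlying.Reachable v w) : p v = p w := by
  obtain ⟨h⟩ := h
  induction h with
  | nil => rfl
  | cons h _ ih =>
    rw [← ih]
    rcases ((SimpleGraph.fromRel_adj _ _ _).1 h).2 with ⟨e, rfl, rfl⟩ | ⟨e, rfl, rfl⟩
    · exact (hp e).symm
    · exact hp e

theorem finrank_constants [Finite V] :
    Module.finrank ℝ G.constants = Nat.card G.underlying.ConnectedComponent := by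
  have := Fintype.ofFinite G.underlying.ConnectedComponent
  rw [Nat.card_eq_fintype_card, ← Module.finrank_fintype_fun_eq_card ℝ]
  apply le_antisymm
  · refine LinearMap.finrank_le_finrank_of_injective
      (f := LinearMap.funLeft ℝ ℝ Quot.out ∘ₗ G.constants.subtype) fun p q hpq => ?_
    ext v
    have hv : G.underlying.Reachable (Quot.out (G.underlying.connectedComponentMk v)) v :=
      SimpleGraph.ConnectedComponent.exact (Quot.out_eq _)
    rw [← G.eq_of_reachable p.2 hv, ← G.eq_of_reachable q.2 hv]
    exact congrFun hpq _
  · refine LinearMap.finrank_le_finrank_of_injective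
      (f := (LinearMap.funLeft ℝ ℝ G.underlying.connectedComponentMk).codRestrict G.constants
        fun p e => ?_) fun p q hpq => ?_
    · simp only [LinearMap.funLeft_apply, connectedComponentMk_head]
    · exact LinearMap.funLeft_injective_of_surjective ℝ ℝ G.underlying.connectedComponentMk
        Quot.mk_surjective (congrArg Subtype.val hpq)

/-- The flows which are conserved at every vertex. -/
def circulations [Fintype E] [DecidableEq V] : Submodule ℝ (E → ℝ) where
  carrier := {f | ∀ v, ∑ e with G.tail e = v, f e - ∑ e with G.head e = v, f e = 0}
  add_mem' := fun {a b} ha hb v => by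
    have h1 := ha v
    have h2 := hb v
    simp only [Pi.add_apply, Finset.sum_add_distrib]
    linarith
  zero_mem' := fun v => by simp
  smul_mem' := fun c f hf v => by
    simp only [Pi.smul_apply, smul_eq_mul, ← Finset.mul_sum, ← mul_sub, hf v, mul_zero]

/-- The incidence matrix has the circulations as kernel, its transpose has the componentwise
constants, and the two ranks agree. -/
theorem finrank_circulations [Fintype V] [Fintype E] [DecidableEq V] :
    Module.finrank ℝ G.circulations + Fintype.card V =
      Fintype.card E + Nat.card G.underlying.ConnectedComponent := by
  let M : Matrix V E ℝ := Matrix.of fun v e =>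
    (if G.tail e = v then 1 else 0) - (if G.head e = v then 1 else 0)
  have h1 : M.mulVecLin.ker = G.circulations := by
    ext f
    simp only [LinearMap.mem_ker, Matrix.mulVecLin_apply, funext_iff, Matrix.mulVec, dotProduct, M,
      Matrix.of_apply, sub_mul, ite_mul, one_mul, zero_mul, Finset.sum_sub_distrib,
      ← Finset.sum_filter, Pi.zero_apply]
    rfl
  have h2 : M.transpose.mulVecLin.ker = G.constants := by
    ext p
    simp only [LinearMap.mem_ker, Matrix.mulVecLin_apply, funext_iff, Matrix.mulVec, dotProduct, M,
      Matrix.of_apply, sub_mul, ite_mul, one_mul, zero_mul, Finset.sum_sub_distrib,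
      Pi.zero_apply, Matrix.transpose_apply, Finset.sum_ite_eq, Finset.mem_univ, if_true,
      sub_eq_zero]
    exact forall_congr' fun e => eq_comm
  have h3 := M.mulVecLin.finrank_range_add_finrank_ker
  have h4 := M.transpose.mulVecLin.finrank_range_add_finrank_ker
  have h5 : Module.finrank ℝ M.transpose.mulVecLin.range = Module.finrank ℝ M.mulVecLin.range :=
    M.rank_transpose
  rw [h1, Module.finrank_fintype_fun_eq_card] at h3
  rw [h2, Module.finrank_fintype_fun_eq_card, finrank_constants] at h4
  omega

theorem sum_src_eq {E : Type*} [Fintype E] [DecidableEq V] (G : MultiDigraph V E)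
    (w : Dart E → ℝ) (v : V) :
    ∑ d with G.src d = v, w d =
      ∑ e with G.tail e = v, w (e, true) + ∑ e with G.head e = v, w (e, false) := by
  rw [Finset.sum_filter, Fintype.sum_prod_type, Finset.sum_filter, Finset.sum_filter,
    ← Finset.sum_add_distrib]
  refine Finset.sum_congr rfl fun e _ => ?_
  rw [Fintype.sum_bool]
  rfl

/-- The flow which sends `w d` units along the boundary of the face on the left of `d`. -/
def boundaryFlow : (Dart E → ℝ) →ₗ[ℝ] (E → ℝ) where
  toFun w e := w (e, false) - w (e, true)
  map_add' w w' := by ext e; simp only [Pi.add_apply]; ring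
  map_smul' c w := by ext e; simp only [Pi.smul_apply, smul_eq_mul, RingHom.id_apply]; ring

variable {G}

/-- Every boundary walk that enters a vertex leaves it again: `ρ` permutes the darts at `v`,
matching each `d` with the reverse of `ρ d`. -/
theorem boundaryFlow_mem_circulations [Fintype E] [DecidableEq V] {ρ : Perm (Dart E)}
    (hρ : ∀ d, G.src (ρ d) = G.src d) {w : Dart E → ℝ} (hw : w ∈ invariants (revPerm E * ρ)) :
    boundaryFlow w ∈ G.circulations := fun v => by
  have h1 : ∑ d with G.src d = v, w d.rev = ∑ d with G.src d = v, w d := by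
    rw [Finset.sum_filter, Finset.sum_filter, ← Equiv.sum_comp ρ]
    refine Finset.sum_congr rfl fun d _ => ?_
    rw [hρ, ← hw d]
    rfl
  rw [sum_src_eq, sum_src_eq] at h1
  simp only [boundaryFlow, LinearMap.coe_mk, AddHom.coe_mk, Finset.sum_sub_distrib]
  simp only [Dart.rev, Bool.not_true, Bool.not_false] at h1
  linarith

open Classical in
-- A function invariant under both permutations is a potential constant along arcs, and isolated
-- vertices may take arbitrary further values; together they embed into `constants`.
theorem finrank_invariants_inf_add_card_le [Fintype V] [Fintype E] {ρ : Perm (Dart E)}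
    (hρ : ∀ d d', G.src d = G.src d' → ρ.SameCycle d d') :
    Module.finrank ℝ ↥(invariants (revPerm E) ⊓ invariants ρ) +
      Fintype.card {v // ∀ d, G.src d ≠ v} ≤ Nat.card G.underlying.ConnectedComponent := by
  have hsrc : ∀ w : ↥(invariants (revPerm E) ⊓ invariants ρ), ∀ d d', G.src d = G.src d' →
      w.1 d = w.1 d' := fun w d d' h => eq_of_sameCycle w.2.2 (hρ d d' h)
  let J : ↥(invariants (revPerm E) ⊓ invariants ρ) × ({v // ∀ d, G.src d ≠ v} → ℝ) →ₗ[ℝ] V → ℝ :=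
    { toFun := fun x v => if h : ∀ d, G.src d ≠ v then x.2 ⟨v, h⟩ else
        x.1.1 (Classical.choose (not_forall.1 h))
      map_add' := fun x y => by
        ext v
        by_cases h : ∀ d, G.src d ≠ v
        · simp [h]
        · simp only [h, dif_neg, not_false_eq_true, Pi.add_apply]; rfl
      map_smul' := fun c x => by
        ext v
        by_cases h : ∀ d, G.src d ≠ v
        · simp [h]
        · simp only [h, dif_neg, not_false_eq_true, Pi.smul_apply]; rfl }
  have hJ1 : ∀ x v, J x v.1 = x.2 v := fun x v => dif_pos v.2
  have hJ2 : ∀ x d, J x (G.src d) = x.1.1 d := fun x d => by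
    have h : ¬ ∀ d', G.src d' ≠ G.src d := fun h => h d rfl
    refine (dif_neg h).trans (hsrc _ _ _ ?_)
    exact not_not.1 (Classical.choose_spec (not_forall.1 h))
  rw [← finrank_constants, ← Module.finrank_fintype_fun_eq_card ℝ, ← Module.finrank_prod]
  refine LinearMap.finrank_le_finrank_of_injective (f := J.codRestrict G.constants
    fun x e => ?_) fun x y hxy => ?_
  · exact (hJ2 x (e, false)).trans ((x.1.2.1 (e, true)).trans (hJ2 x (e, true)).symm)
  · have hxy : J x = J y := congrArg Subtype.val hxy
    refine Prod.ext (Subtype.ext (funext fun d => ?_)) (funext fun v => ?_)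
    · rw [← hJ2, hxy, hJ2]
    · rw [← hJ1, hxy, hJ1]

open Classical in
/-- The genus of a rotation system is nonnegative. -/
theorem orbitCount_add_card_le [Fintype V] [Fintype E] {ρ : Perm (Dart E)}
    (hρ : ∀ d d', ρ.SameCycle d d' ↔ G.src d = G.src d') :
    orbitCount (revPerm E * ρ) + Fintype.card V + Fintype.card {v // ∀ d, G.src d ≠ v} ≤
      Fintype.card E + 2 * Nat.card G.underlying.ConnectedComponent := by
  have hsrc : ∀ d, G.src (ρ d) = G.src d := fun d => (hρ _ _).1 (Perm.sameCycle_apply_left.2 .rfl)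
  let Φ : invariants (revPerm E * ρ) →ₗ[ℝ] G.circulations :=
    (boundaryFlow ∘ₗ (invariants (revPerm E * ρ)).subtype).codRestrict G.circulations
      fun w => boundaryFlow_mem_circulations hsrc w.2
  -- A face function with zero boundary flow agrees on both sides of every arc, so reversal
  -- invariance turns face invariance into `ρ`-invariance.
  have hΦ : ∀ w : Φ.ker, w.1.1 ∈ invariants (revPerm E) ⊓ invariants ρ := fun w => by
    have h1 : ∀ e, w.1.1 (e, false) = w.1.1 (e, true) := fun e =>
      sub_eq_zero.1 (congrFun (congrArg Subtype.val w.2) e)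
    have h2 : ∀ d : Dart E, w.1.1 d.rev = w.1.1 d := by
      rintro ⟨e, b⟩
      cases b
      · exact (h1 e).symm
      · exact h1 e
    exact ⟨h2, fun d => (h2 _).symm.trans (w.1.2 d)⟩
  have h1 : Module.finrank ℝ Φ.ker ≤ Module.finrank ℝ ↥(invariants (revPerm E) ⊓ invariants ρ) :=
    LinearMap.finrank_le_finrank_of_injective
      (f := ((invariants (revPerm E * ρ)).subtype ∘ₗ Φ.ker.subtype).codRestrict _ hΦ)
      fun f g hfg => by
        have hfg : f.1.1 = g.1.1 :=
          congrArg (fun g : ↥(invariants (revPerm E) ⊓ invariants ρ) => g.1) hfg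
        exact Subtype.ext (Subtype.ext hfg)
  have h2 := Φ.finrank_range_add_finrank_ker
  have h3 := Submodule.finrank_le Φ.range
  have h4 := G.finrank_circulations
  have h5 := finrank_invariants_inf_add_card_le fun d d' => (hρ d d').2
  rw [orbitCount]
  omega

/-- The number of orbits of a rotation is at least the number of vertices on arcs. -/
theorem card_le_orbitCount_add [Fintype V] [Finite E] {ρ : Perm (Dart E)}
    (hρ : ∀ d, G.src (ρ d) = G.src d) :
    Fintype.card V ≤ orbitCount ρ + Nat.card {v // ∀ d, G.src d ≠ v} := by
  classical
  rw [Nat.card_eq_fintype_card, ← Module.finrank_fintype_fun_eq_card ℝ,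
    ← Module.finrank_fintype_fun_eq_card ℝ, orbitCount, ← Module.finrank_prod]
  refine LinearMap.finrank_le_finrank_of_injective
    (f := LinearMap.prod ((LinearMap.funLeft ℝ ℝ G.src).codRestrict (invariants ρ)
      fun p d => by simp [LinearMap.funLeft_apply, hρ]) (LinearMap.funLeft ℝ ℝ Subtype.val))
    fun p q hpq => ?_
  ext v
  by_cases h : ∀ d, G.src d ≠ v
  · exact congrFun (congrArg Prod.snd hpq) ⟨v, h⟩
  · push Not at h
    obtain ⟨d, rfl⟩ := h
    exact congrFun (congrArg Subtype.val (congrArg Prod.fst hpq)) d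

end MultiDigraph

/-! ### Planarity from rotation systems -/

theorem orbitCount_le_conj {D : Type*} [Finite D] (ρ g : Perm D) :
    orbitCount ρ ≤ orbitCount (g * ρ * g⁻¹) := by
  refine LinearMap.finrank_le_finrank_of_injective
    (f := (LinearMap.funLeft ℝ ℝ (g⁻¹ : Perm D) ∘ₗ (invariants ρ).subtype).codRestrict
      (invariants (g * ρ * g⁻¹)) fun f x => ?_) fun f f' h => ?_
  · have := f.2 (g⁻¹ x)
    simpa [LinearMap.funLeft_apply] using this
  · exact Subtype.ext (LinearMap.funLeft_injective_of_surjective ℝ ℝ _ (g⁻¹ : Perm D).surjective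
      (congrArg (fun f : invariants (g * ρ * g⁻¹) => f.1) h))

namespace MultiDigraph

variable {V E : Type*} {G : MultiDigraph V E}

theorem card_connectedComponent_eq_one (hc : G.underlying.Connected) :
    Nat.card G.underlying.ConnectedComponent = 1 := by
  have := hc.preconnected.subsingleton_connectedComponent
  obtain ⟨v⟩ := hc.nonempty
  exact Nat.card_eq_one_iff_unique.2 ⟨this, ⟨G.underlying.connectedComponentMk v⟩⟩

theorem src_surjective [Nonempty E] (hc : G.underlying.Connected) : Function.Surjective G.src := by
  obtain ⟨e⟩ := ‹Nonempty E›
  intro v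
  have h := G.eq_of_reachable (p := fun v => ∃ d, G.src d = v)
    (fun e => propext ⟨fun _ => ⟨(e, true), rfl⟩, fun _ => ⟨(e, false), rfl⟩⟩)
    (hc.preconnected (G.tail e) v)
  exact h.mp ⟨(e, true), rfl⟩

/-- Treated separately because without darts there are no orbits, although the sphere around a
single vertex has one face. -/
theorem isPlanar_of_isEmpty [Fintype V] [Fintype E] [IsEmpty E] (hc : G.underlying.Connected) :
    IsPlanar G := by
  have hV : Subsingleton V :=
    ⟨fun v w => G.eq_of_reachable (p := id) (fun e => isEmptyElim e) (hc.preconnected v w)⟩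
  obtain ⟨v⟩ := hc.nonempty
  have hV1 : Fintype.card V = 1 := Fintype.card_eq_one_iff.2 ⟨v, fun w => Subsingleton.elim _ _⟩
  refine ⟨1, ⟨
    { rot := 1
      rot_sameCycle := fun d => isEmptyElim d.1
      left := fun d => isEmptyElim d.1
      left_rev_rot := fun d => isEmptyElim d.1
      isolatedFace := fun _ => 0
      connected := ?_
      euler := ?_ }⟩⟩
  · have h : ∀ x : V ⊕ Fin 1, (SimpleGraph.fromRel fun x y : V ⊕ Fin 1 =>
        (∃ d, x = Sum.inl (G.src d) ∧ y = Sum.inr (isEmptyElim d.1)) ∨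
        (∃ v : {v // ∀ d, G.src d ≠ v}, x = Sum.inl v.1 ∧ y = Sum.inr 0)).Reachable
          (Sum.inl v) x := by
      rintro (w | i)
      · rw [Subsingleton.elim w v]
      · refine SimpleGraph.Adj.reachable ((SimpleGraph.fromRel_adj _ _ _).2 ⟨Sum.inl_ne_inr, ?_⟩)
        exact Or.inl (Or.inr ⟨⟨v, fun d => isEmptyElim d.1⟩, rfl,
          congrArg Sum.inr (Subsingleton.elim _ _)⟩)
    exact (SimpleGraph.connected_iff _).2 ⟨fun x y => (h x).symm.trans (h y), ⟨Sum.inl v⟩⟩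
  · rw [card_connectedComponent_eq_one hc, hV1, Fintype.card_eq_zero (α := E), Fintype.card_fin]

/-- The rotation may have several cycles at a vertex. Merging them preserves the inequality, and
with at least |V| cycles left it becomes one half of Euler's formula. -/
theorem isPlanar_of_orbitCount_le [Fintype V] [Fintype E] [Nonempty E]
    (hc : G.underlying.Connected) {ρ : Perm (Dart E)} (hρ : ∀ d, G.src (ρ d) = G.src d)
    (h : orbitCount ρ + Fintype.card E + 2 ≤ orbitCount (revPerm E * ρ) + 2 * Fintype.card V) :
    IsPlanar G := by
  classical
  have hsurj := src_surjective hc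
  obtain ⟨ρ', hρ', hle⟩ := exists_merge G.src (revPerm E) _ ρ le_rfl hρ
  have hsrc : ∀ d, G.src (ρ' d) = G.src d :=
    fun d => (hρ' _ _).1 (Perm.sameCycle_apply_left.2 .rfl)
  obtain ⟨q, hq, hq'⟩ := exists_orbit_labelling (revPerm E * ρ')
  refine ⟨_, ⟨
    { rot := ρ'
      rot_sameCycle := hρ'
      left := q
      left_rev_rot := hq'
      isolatedFace := fun v => absurd (hsurj v.1) fun ⟨d, hd⟩ => v.2 d hd
      connected := ?_
      euler := ?_ }⟩⟩
  · set Γ := SimpleGraph.fromRel _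
    have hadj : ∀ d, Γ.Reachable (Sum.inl (G.src d)) (Sum.inr (q d)) := fun d =>
      SimpleGraph.Adj.reachable ((SimpleGraph.fromRel_adj _ _ _).2
        ⟨Sum.inl_ne_inr, Or.inl (Or.inl ⟨d, rfl, rfl⟩)⟩)
    have hV : ∀ v w, Γ.Reachable (Sum.inl v) (Sum.inl w) := fun v w =>
      SimpleGraph.ConnectedComponent.exact <|
        G.eq_of_reachable (p := fun v => Γ.connectedComponentMk (Sum.inl v))
          (fun e => SimpleGraph.ConnectedComponent.sound <| by
            -- The rotation predecessor of the backward dart leaves the head of `e` and borders the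
            -- face `q (e, true)`, so both ends of `e` touch that face.
            have h1 := hadj (ρ'⁻¹ (e, false))
            have h2 := hq' (ρ'⁻¹ (e, false))
            have h3 := hsrc (ρ'⁻¹ (e, false))
            have h4 : ρ' (ρ'⁻¹ (e, false)) = (e, false) := by
              rw [← Perm.mul_apply, mul_inv_cancel, Perm.one_apply]
            rw [Perm.mul_apply, h4] at h2
            rw [h4] at h3
            rw [← h3, ← h2] at h1
            exact h1.trans (hadj (e, true)).symm) (hc.preconnected v w)
    obtain ⟨v⟩ := hc.nonempty
    have hr : ∀ x, Γ.Reachable (Sum.inl v) x := by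
      rintro (w | i)
      · exact hV v w
      · obtain ⟨d, rfl⟩ := hq i
        exact (hV _ _).trans (hadj d)
    exact (SimpleGraph.connected_iff _).2 ⟨fun x y => (hr x).symm.trans (hr y), ⟨Sum.inl v⟩⟩
  · have h1 := orbitCount_add_card_le hρ'
    have h2 := card_le_orbitCount hsurj hsrc
    rw [card_connectedComponent_eq_one hc] at h1 ⊢
    rw [Fintype.card_fin]
    omega

end MultiDigraph

/-! ### The dual rotation system -/

namespace PlaneEmbedding

variable {V E H : Type*} [Fintype V] [Fintype E] [Fintype H] {G : MultiDigraph V E}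
  (P : PlaneEmbedding G H)

theorem src_rot (d : Dart E) : G.src (P.rot d) = G.src d :=
  (P.rot_sameCycle _ _).1 (Perm.sameCycle_apply_left.2 .rfl)

@[simp] theorem src_dualGraph (d : Dart E) : P.dualGraph.src d = P.left d := by
  obtain ⟨e, b⟩ := d; cases b <;> rfl

theorem nonempty_faces (P : PlaneEmbedding G H) : Nonempty H := by
  obtain ⟨v | h⟩ := P.connected.nonempty
  · by_cases hv : ∀ d, G.src d ≠ v
    · exact ⟨P.isolatedFace ⟨v, hv⟩⟩
    · push Not at hv
      exact ⟨P.left hv.choose⟩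
  · exact ⟨h⟩

/-- The geometric dual graph is connected, even if the graph is not. -/
theorem eq_of_left_eq_right {T : Type*} {π : H → T}
    (hπ : ∀ e, π (P.right (e, true)) = π (P.left (e, true))) (g h : H) : π g = π h := by
  have hrev : ∀ d, π (P.left d.rev) = π (P.left d) := by
    rintro ⟨e, b⟩
    cases b
    · exact (hπ e).symm
    · exact hπ e
  have hrot : ∀ d d', G.src d = G.src d' → π (P.left d) = π (P.left d') := fun d d' hd =>
    eq_of_sameCycle (f := fun d => π (P.left d))
      (fun d => by rw [← hrev, P.left_rev_rot]) ((P.rot_sameCycle d d').2 hd)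
  classical
  -- All faces around a vertex share one value, so `π` extends to the vertices and is constant along
  -- incidences.
  let p : V ⊕ H → T := Sum.elim (fun v => if hv : ∀ d, G.src d ≠ v then π (P.isolatedFace ⟨v, hv⟩)
    else π (P.left (Classical.choose (not_forall.1 hv)))) π
  refine fromRel_eq_of_connected (f := p) P.connected.preconnected ?_ (Sum.inr g) (Sum.inr h)
  rintro _ _ (⟨d, rfl, rfl⟩ | ⟨v, rfl, rfl⟩)
  · have hv : ¬ ∀ d', G.src d' ≠ G.src d := fun hd => hd d rfl
    exact (dif_neg hv).trans (hrot _ _ (not_not.1 (Classical.choose_spec (not_forall.1 hv))))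
  · exact dif_pos v.2

/-- The rotation system which walks along the boundaries of the faces. A face may have several
boundary walks. -/
def dualRot : Perm (Dart E) := P.rot⁻¹ * revPerm E

theorem left_dualRot (d : Dart E) : P.left (P.dualRot d) = P.left d := by
  rw [← P.left_rev_rot (P.dualRot d), dualRot, ← Perm.mul_apply, mul_inv_cancel_left,
    revPerm_apply, Dart.rev_rev]

/-- Duality swaps the two counts: `dualRot` is inverse to the face permutation of `G`, and its own
face permutation is conjugate to the inverse of `rot`. Euler's formula and the genus bound for `G`
then combine. -/
theorem orbitCount_dualRot_le :
    orbitCount P.dualRot + Fintype.card E + 2 ≤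
      orbitCount (revPerm E * P.dualRot) + 2 * Fintype.card H := by
  classical
  have hinv : (revPerm E)⁻¹ = revPerm E := rfl
  have h1 : orbitCount P.dualRot = orbitCount (revPerm E * P.rot) := by
    rw [← orbitCount_inv, dualRot, mul_inv_rev, inv_inv, hinv]
  have h2 := orbitCount_le_conj P.rot⁻¹ (revPerm E)
  rw [orbitCount_inv, hinv, mul_assoc] at h2
  have h3 := MultiDigraph.orbitCount_add_card_le P.rot_sameCycle
  have h4 := MultiDigraph.card_le_orbitCount_add P.src_rot
  rw [Nat.card_eq_fintype_card] at h4
  have h5 := P.euler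
  rw [dualRot] at h1 ⊢
  omega

end PlaneEmbedding

/-! ### Duplicating arcs -/

section Doubling

variable {E : Type*} {S : Dart E → Prop} (hS : ∀ d, S d ∨ S d.rev)

/-- The graph whose arcs are a set of darts. -/
def MultiDigraph.ofDarts {V : Type*} (G : MultiDigraph V E) (S : Dart E → Prop) :
    MultiDigraph V {d // S d} where
  tail a := G.src a.1
  head a := G.dst a.1

/-- The dart which a dart of `ofDarts` runs along. -/
def underlyingDart (x : Dart {d // S d}) : Dart E := if x.2 then x.1.1 else x.1.1.rev

theorem MultiDigraph.src_ofDarts {V : Type*} (G : MultiDigraph V E) (x : Dart {d // S d}) :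
    (G.ofDarts S).src x = G.src (underlyingDart x) := by
  obtain ⟨d, b⟩ := x
  cases b
  · exact (G.src_rev d.1).symm
  · rfl

open Classical in
/-- The first of the at most two darts that run along `d`. -/
noncomputable def firstCopy (d : Dart E) : Dart {d // S d} :=
  if h : S d then (⟨d, h⟩, true) else (⟨d.rev, (hS d).resolve_left h⟩, false)

theorem firstCopy_of_mem {d : Dart E} (h : S d) : firstCopy hS d = (⟨d, h⟩, true) := dif_pos h

theorem firstCopy_of_not_mem {d : Dart E} (h : ¬ S d) :
    firstCopy hS d = (⟨d.rev, (hS d).resolve_left h⟩, false) := dif_neg h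

theorem underlyingDart_firstCopy (d : Dart E) : underlyingDart (firstCopy hS d) = d := by
  by_cases h : S d
  · rw [firstCopy_of_mem hS h]; rfl
  · rw [firstCopy_of_not_mem hS h]; exact d.rev_rev

open Classical in
/-- The rotation in which the two darts that run along the same dart are consecutive. -/
noncomputable def doubleRotFun (ρ : Perm (Dart E)) (x : Dart {d // S d}) : Dart {d // S d} :=
  if h : x.2 = true ∧ S x.1.1.rev then (⟨x.1.1.rev, h.2⟩, false)
  else firstCopy hS (ρ (underlyingDart x))

variable (ρ : Perm (Dart E))

theorem doubleRotFun_of_pos {x : Dart {d // S d}} (h : x.2 = true ∧ S x.1.1.rev) :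
    doubleRotFun hS ρ x = (⟨x.1.1.rev, h.2⟩, false) := dif_pos h

theorem doubleRotFun_of_neg {x : Dart {d // S d}} (h : ¬ (x.2 = true ∧ S x.1.1.rev)) :
    doubleRotFun hS ρ x = firstCopy hS (ρ (underlyingDart x)) := dif_neg h

theorem firstCopy_ne {x : Dart {d // S d}} (h : x.2 = true ∧ S x.1.1.rev) (d : Dart E) :
    ((⟨x.1.1.rev, h.2⟩, false) : Dart {d // S d}) ≠ firstCopy hS d := fun he => by
  by_cases hd : S d
  · rw [firstCopy_of_mem hS hd] at he
    exact Bool.false_ne_true (congrArg Prod.snd he)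
  · rw [firstCopy_of_not_mem hS hd] at he
    have h1 : x.1.1.rev = d.rev := congrArg (fun y => y.1.1) he
    have h2 : x.1.1 = d := by rw [← x.1.1.rev_rev, h1, Dart.rev_rev]
    exact hd (h2 ▸ x.1.2)

theorem doubleRotFun_injective : Function.Injective (doubleRotFun hS ρ) := fun x y hxy => by
  by_cases hx : x.2 = true ∧ S x.1.1.rev <;> by_cases hy : y.2 = true ∧ S y.1.1.rev
  · rw [doubleRotFun_of_pos hS ρ hx, doubleRotFun_of_pos hS ρ hy] at hxy
    have h1 : x.1.1.rev = y.1.1.rev := congrArg (fun y => y.1.1) hxy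
    refine Prod.ext (Subtype.ext ?_) (hx.1.trans hy.1.symm)
    rw [← x.1.1.rev_rev, h1, Dart.rev_rev]
  · rw [doubleRotFun_of_pos hS ρ hx, doubleRotFun_of_neg hS ρ hy] at hxy
    exact absurd hxy (firstCopy_ne hS hx _)
  · rw [doubleRotFun_of_neg hS ρ hx, doubleRotFun_of_pos hS ρ hy] at hxy
    exact absurd hxy.symm (firstCopy_ne hS hy _)
  · rw [doubleRotFun_of_neg hS ρ hx, doubleRotFun_of_neg hS ρ hy] at hxy
    have h1 := congrArg underlyingDart hxy
    rw [underlyingDart_firstCopy, underlyingDart_firstCopy] at h1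
    have h2 := ρ.injective h1
    obtain ⟨⟨d, hd⟩, b⟩ := x
    obtain ⟨⟨d', hd'⟩, b'⟩ := y
    cases b <;> cases b' <;> simp only [underlyingDart, if_true, if_false, Bool.false_eq_true,
      true_and, false_and, not_false_eq_true] at h2 hx hy
    · have h3 : d = d' := by rw [← d.rev_rev, h2, Dart.rev_rev]
      subst h3; rfl
    · rw [← h2, Dart.rev_rev] at hy
      exact absurd hd hy
    · rw [h2, Dart.rev_rev] at hx
      exact absurd hd' hx
    · subst h2; rfl

variable [Finite E]

/-- The rotation in which the two darts that run along the same dart are consecutive. -/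
noncomputable def doubleRot : Perm (Dart {d // S d}) :=
  Equiv.ofBijective _ (Finite.injective_iff_bijective.1 (doubleRotFun_injective hS ρ))

theorem doubleRot_of_pos {x : Dart {d // S d}} (h : x.2 = true ∧ S x.1.1.rev) :
    doubleRot hS ρ x = (⟨x.1.1.rev, h.2⟩, false) := dif_pos h

theorem doubleRot_of_neg {x : Dart {d // S d}} (h : ¬ (x.2 = true ∧ S x.1.1.rev)) :
    doubleRot hS ρ x = firstCopy hS (ρ (underlyingDart x)) := dif_neg h

theorem src_doubleRot {V : Type*} {G : MultiDigraph V E} (hρ : ∀ d, G.src (ρ d) = G.src d)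
    (x : Dart {d // S d}) : (G.ofDarts S).src (doubleRot hS ρ x) = (G.ofDarts S).src x := by
  rw [MultiDigraph.src_ofDarts, MultiDigraph.src_ofDarts]
  by_cases hx : x.2 = true ∧ S x.1.1.rev
  · rw [doubleRot_of_pos hS ρ hx]
    simp [underlyingDart, hx.1]
  · rw [doubleRot_of_neg hS ρ hx, underlyingDart_firstCopy, hρ]

/-- A second copy directly follows the first in the rotation, so an invariant function is determined
by the first copies, where it is `ρ`-invariant. -/
theorem orbitCount_doubleRot_le : orbitCount (doubleRot hS ρ) ≤ orbitCount ρ := by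
  have key : ∀ w ∈ invariants (doubleRot hS ρ), ∀ x,
      w (firstCopy hS (ρ (underlyingDart x))) = w x := fun w hw x => by
    by_cases hx : x.2 = true ∧ S x.1.1.rev
    · rw [← hw x, doubleRot_of_pos hS ρ hx, ← hw (_, false), doubleRot_of_neg hS ρ (by simp)]
      simp [underlyingDart, hx.1]
    · rw [← hw x, doubleRot_of_neg hS ρ hx]
  refine LinearMap.finrank_le_finrank_of_injective
    (f := (LinearMap.funLeft ℝ ℝ (firstCopy hS) ∘ₗ
      (invariants (doubleRot hS ρ)).subtype).codRestrict (invariants ρ) fun w d => ?_)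
    fun w w' h => ?_
  · have := key w.1 w.2 (firstCopy hS d)
    rwa [underlyingDart_firstCopy] at this
  · have h : w.1 ∘ firstCopy hS = w'.1 ∘ firstCopy hS :=
      congrArg (fun f : invariants ρ => f.1) h
    ext x
    rw [← key w.1 w.2, ← key w'.1 w'.2]
    exact congrFun h _

theorem card_le_orbitCount_rev_mul_doubleRot :
    orbitCount (revPerm E * ρ) + Nat.card {e // S (e, true) ∧ S (e, false)} ≤
      orbitCount (revPerm _ * doubleRot hS ρ) := by
  classical
  have := Fintype.ofFinite {e // S (e, true) ∧ S (e, false)}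
  obtain ⟨q, hq, hq'⟩ := exists_orbit_labelling (revPerm E * ρ)
  have hU : ∀ x : Dart {d // S d}, S x.1.1.rev → S (x.1.1.1, true) ∧ S (x.1.1.1, false) := by
    rintro ⟨⟨⟨e, b⟩, h⟩, b'⟩ h'
    cases b
    · exact ⟨h', h⟩
    · exact ⟨h, h'⟩
  -- Face labels after doubling: a first copy that has a parallel second copy borders the new
  -- two-sided face of its arc; every other dart keeps the old face.
  let l : Dart {d // S d} → Fin (orbitCount (revPerm E * ρ)) ⊕ {e // S (e, true) ∧ S (e, false)} :=
    fun x => if h : x.2 = true ∧ S x.1.1.rev then Sum.inr ⟨x.1.1.1, hU x h.2⟩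
      else Sum.inl (q (underlyingDart x))
  have hl1 : ∀ x (h : x.2 = true ∧ S x.1.1.rev), l x = Sum.inr ⟨x.1.1.1, hU x h.2⟩ :=
    fun x h => dif_pos h
  have hl2 : ∀ x, ¬ (x.2 = true ∧ S x.1.1.rev) → l x = Sum.inl (q (underlyingDart x)) :=
    fun x h => dif_neg h
  have hcard := card_le_orbitCount (ρ := revPerm _ * doubleRot hS ρ) (q := l) ?_ fun x => ?_
  · rwa [Fintype.card_sum, Fintype.card_fin, ← Nat.card_eq_fintype_card] at hcard
  · rintro (i | ⟨e, he⟩)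
    · obtain ⟨d, rfl⟩ := hq i
      by_cases hd : S d.rev
      · refine ⟨(⟨d.rev, hd⟩, false), (hl2 _ (by simp)).trans ?_⟩
        simp [underlyingDart]
      · exact ⟨(⟨d, (hS d).resolve_right hd⟩, true), hl2 _ fun h => hd h.2⟩
    · exact ⟨(⟨(e, true), he.1⟩, true), hl1 (⟨(e, true), he.1⟩, true) ⟨rfl, he.2⟩⟩
  · rw [Perm.mul_apply, revPerm_apply]
    by_cases hx : x.2 = true ∧ S x.1.1.rev
    · rw [doubleRot_of_pos hS ρ hx, hl1 x hx, hl1 _ ⟨rfl, (Dart.rev_rev x.1.1).symm ▸ x.1.2⟩]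
      rfl
    · have hqx := hq' (underlyingDart x)
      rw [Perm.mul_apply, revPerm_apply] at hqx
      rw [doubleRot_of_neg hS ρ hx, hl2 x hx, ← hqx]
      by_cases hy : S (ρ (underlyingDart x))
      · rw [firstCopy_of_mem hS hy]
        exact hl2 _ fun h => Bool.false_ne_true h.1
      · rw [firstCopy_of_not_mem hS hy]
        exact hl2 _ fun h => hy (by simpa [Dart.rev] using h.2)

end Doubling

/-- Each doubled arc adds one arc and at least one face, so the inequality passes to `doubleRot`. -/
theorem isPlanar_ofDarts {V E : Type*} [Fintype V] [Fintype E] {G : MultiDigraph V E}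
    {S : Dart E → Prop} [Fintype {d // S d}] (hS : ∀ e, S (e, false))
    (hc : (G.ofDarts S).underlying.Connected)
    {ρ : Perm (Dart E)} (hρ : ∀ d, G.src (ρ d) = G.src d)
    (h : orbitCount ρ + Fintype.card E + 2 ≤ orbitCount (revPerm E * ρ) + 2 * Fintype.card V) :
    IsPlanar (G.ofDarts S) := by
  classical
  rcases isEmpty_or_nonempty {d // S d} with hE | hE
  · exact MultiDigraph.isPlanar_of_isEmpty hc
  have hS' : ∀ d, S d ∨ S d.rev := by
    rintro ⟨e, b⟩
    cases b
    · exact Or.inl (hS e)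
    · exact Or.inr (hS e)
  refine MultiDigraph.isPlanar_of_orbitCount_le hc (src_doubleRot hS' ρ hρ) ?_
  have h1 := orbitCount_doubleRot_le hS' ρ
  have h2 := card_le_orbitCount_rev_mul_doubleRot hS' ρ
  have h3 : Fintype.card {d // S d} ≤
      Fintype.card (E ⊕ {e // S (e, true) ∧ S (e, false)}) :=
    Fintype.card_le_of_injective (fun a => if h : a.1.2 = true then
      Sum.inr ⟨a.1.1, by have := a.2; rwa [← h], hS _⟩ else Sum.inl a.1.1) <| by
      rintro ⟨⟨e, b⟩, h⟩ ⟨⟨e', b'⟩, h'⟩ hee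
      cases b <;> cases b' <;> simp_all
  rw [Fintype.card_sum, ← Nat.card_eq_fintype_card (α := {e // S (e, true) ∧ S (e, false)})] at h3
  omega

/-! ### Optimal values and complementary slackness -/

theorem MinProblem.IsOptimal.value_eq {X : Type*} {p : MinProblem X} {x : X} (h : p.IsOptimal x) :
    p.value = (p.objective x : EReal) :=
  le_antisymm (iInf₂_le x h.1) (le_iInf₂ fun y hy => EReal.coe_le_coe_iff.2 (h.2 y hy))

theorem MinProblem.value_eq_top {X : Type*} {p : MinProblem X} (h : ¬ p.feasible.Nonempty) :
    p.value = ⊤ :=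
  top_unique (le_iInf₂ fun x hx => absurd ⟨x, hx⟩ h)

theorem MinProblem.value_eq_bot {X : Type*} {p : MinProblem X}
    (h : ∀ β : ℝ, ∃ x ∈ p.feasible, p.objective x < β) : p.value = ⊥ := by
  refine (EReal.eq_bot_iff_forall_lt _).2 fun β => ?_
  obtain ⟨x, hx, hxβ⟩ := h β
  exact (iInf₂_le x hx).trans_lt (EReal.coe_lt_coe_iff.2 hxβ)

namespace LinearProgram

variable {I J : Type*} [Fintype I] [Fintype J] {L : LinearProgram I J} {p : MinProblem (J → ℝ)}

theorem exists_isOptimal (hf : L.feasible = p.feasible)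
    (ho : ∀ x, dotProduct L.c x = -p.objective x) (hP : p.feasible.Nonempty)
    (hD : L.dual.feasible.Nonempty) :
    ∃ x y, p.IsOptimal x ∧ L.dual.IsOptimal y ∧ p.objective x = -L.dual.objective y := by
  obtain ⟨x, hx, y, hy, h⟩ := L.strong_duality (hf ▸ hP) hD
  refine ⟨x, y, ⟨hf ▸ hx, fun z hz => ?_⟩, ⟨hy, fun z hz => ?_⟩, ?_⟩
  · have := L.weak_duality (hf ▸ hz : z ∈ L.feasible) hy
    rw [← h, ho, ho] at this
    linarith
  · rw [← h]
    exact L.weak_duality hx hz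
  · rw [← h, ho, neg_neg]

/-- If just one problem is feasible it must be unbounded, since a bound would give the other a
feasible point. If neither is, both values are `⊤` and the equation fails, whence the hypothesis. -/
theorem value_eq_neg_value_dual (hf : L.feasible = p.feasible)
    (ho : ∀ x, dotProduct L.c x = -p.objective x)
    (h : p.feasible.Nonempty ∨ L.dual.feasible.Nonempty) : p.value = -L.dual.value := by
  by_cases hP : p.feasible.Nonempty <;> by_cases hD : L.dual.feasible.Nonempty
  · obtain ⟨x, y, hx, hy, hxy⟩ := exists_isOptimal hf ho hP hD
    rw [hx.value_eq, hy.value_eq, hxy, EReal.coe_neg]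
  · rw [MinProblem.value_eq_top hD, EReal.neg_top]
    refine MinProblem.value_eq_bot fun β => ?_
    by_contra! hc
    obtain ⟨y, hy, -⟩ := L.exists_dual_le (β := -β) (hf ▸ hP) fun x hx => by
      rw [ho]
      exact neg_le_neg (hc x (hf ▸ hx))
    exact hD ⟨y, hy⟩
  · rw [MinProblem.value_eq_top hP, eq_comm, EReal.neg_eq_top_iff]
    refine MinProblem.value_eq_bot fun β => ?_
    by_contra! hc
    obtain ⟨x, hx, -⟩ := L.exists_le_dotProduct hD hc
    exact hP ⟨x, hf ▸ hx⟩
  · exact absurd h (not_or.2 ⟨hP, hD⟩)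

/-- The duality gap is a sum of products of multipliers and slacks, nonnegative at feasible points;
it vanishes exactly when each product does. -/
theorem isOptimal_iff_complementary_slackness (hf : L.feasible = p.feasible)
    (ho : ∀ x, dotProduct L.c x = -p.objective x) {y : I → ℝ} (hy : L.dual.IsOptimal y)
    (x : J → ℝ) : p.IsOptimal x ↔ ∀ i, Matrix.mulVec L.A x i ≤ L.b i ∧
      (0 < y i → L.b i ≤ Matrix.mulVec L.A x i) := by
  have hgap := L.objective_sub_eq_sum hy.1 x
  constructor
  · intro hx i
    have hxL : x ∈ L.feasible := hf ▸ hx.1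
    refine ⟨hxL i, fun hi => ?_⟩
    obtain ⟨x', y', hx', hy', h⟩ := exists_isOptimal hf ho ⟨x, hx.1⟩ ⟨y, hy.1⟩
    have h1 := hx.2 x' hx'.1
    have h2 := hy.2 y' hy'.1
    have h3 : ∀ i ∈ Finset.univ, 0 ≤ y i * (L.b i - Matrix.mulVec L.A x i) :=
      fun i _ => mul_nonneg (hy.1.2 i) (sub_nonneg.2 (hxL i))
    have h4 : ∑ i, y i * (L.b i - Matrix.mulVec L.A x i) = 0 := by
      refine le_antisymm ?_ (Finset.sum_nonneg h3)
      rw [← hgap, ho]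
      linarith
    have h5 := (Finset.sum_eq_zero_iff_of_nonneg h3).1 h4 i (Finset.mem_univ i)
    have h6 := (mul_eq_zero.1 h5).resolve_left hi.ne'
    linarith
  · intro h
    have h0 : ∑ i, y i * (L.b i - Matrix.mulVec L.A x i) = 0 := by
      refine Finset.sum_eq_zero fun i _ => ?_
      rcases (hy.1.2 i).eq_or_lt with hi | hi
      · rw [← hi, zero_mul]
      · rw [le_antisymm (h i).1 ((h i).2 hi), sub_self, mul_zero]
    rw [h0, ho] at hgap
    refine ⟨hf ▸ (fun i => (h i).1 : x ∈ L.feasible), fun z hz => ?_⟩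
    have := L.weak_duality (hf ▸ hz : z ∈ L.feasible) hy.1
    rw [ho] at this
    linarith

end LinearProgram

namespace FlowNetwork

theorem coe_lpdCost {V E : Type*} [Fintype V] (N : FlowNetwork V E) (a : N.LpdArc) :
    (N.lpdCost a : WithTop ℝ) = N.dartCap a.1 :=
  WithTop.coe_untop _ _

theorem dartCap_false_ne_top {V E : Type*} [Fintype V] (N : FlowNetwork V E) (e : E) :
    N.dartCap (e, false) ≠ ⊤ :=
  WithTop.coe_ne_top

variable {V E H : Type*} [Fintype V] [Fintype E] [Fintype H] (N : FlowNetwork V E)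
  (P : PlaneEmbedding N.toMultiDigraph H)

/-! ### Circulations are face flows -/

theorem faceFlow_eq_boundaryFlow (π : H → ℝ) :
    N.faceFlow P π = MultiDigraph.boundaryFlow fun d => π (P.left d) := rfl

theorem faceFlow_mem_circulations [DecidableEq V] (π : H → ℝ) :
    N.faceFlow P π ∈ N.circulations := by
  rw [faceFlow_eq_boundaryFlow]
  exact MultiDigraph.boundaryFlow_mem_circulations P.src_rot fun d => congrArg π (P.left_rev_rot d)

/-- A dimension count: the kernel is at most one-dimensional, and Euler's formula makes the
circulation space of dimension |H| - 1. -/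
theorem exists_faceFlow_eq [DecidableEq V] {f : E → ℝ} (hf : f ∈ N.circulations) :
    ∃ π : H → ℝ, N.faceFlow P π = f := by
  let F : (H → ℝ) →ₗ[ℝ] N.circulations :=
    (MultiDigraph.boundaryFlow ∘ₗ LinearMap.funLeft ℝ ℝ P.left).codRestrict _
      (N.faceFlow_mem_circulations P)
  obtain ⟨h₀⟩ := P.nonempty_faces
  have h1 : Module.finrank ℝ F.ker ≤ 1 := by
    rw [← Module.finrank_self ℝ]
    refine LinearMap.finrank_le_finrank_of_injective
      (f := LinearMap.proj h₀ ∘ₗ F.ker.subtype) fun π π' h => ?_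
    have hc : ∀ π : F.ker, ∀ g, π.1 g = π.1 h₀ := fun π g =>
      P.eq_of_left_eq_right (fun e => sub_eq_zero.1 (congrFun (congrArg Subtype.val π.2) e)) g h₀
    ext g
    rw [hc π, hc π']
    exact h
  have h2 := F.finrank_range_add_finrank_ker
  have h3 := N.toMultiDigraph.finrank_circulations
  have h4 := P.euler
  rw [Module.finrank_fintype_fun_eq_card] at h2
  have h5 : F.range = ⊤ := Submodule.eq_top_of_finrank_eq
    (le_antisymm (Submodule.finrank_le _) (by omega))
  obtain ⟨π, hπ⟩ := LinearMap.range_eq_top.1 h5 ⟨f, hf⟩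
  exact ⟨π, congrArg Subtype.val hπ⟩

theorem exists_faceFlow_eq_of_feasible [DecidableEq V] (hN : N.IsCirculation) {f : E → ℝ}
    (hf : f ∈ N.minCostFlow.feasible) : ∃ π : H → ℝ, N.faceFlow P π = f :=
  N.exists_faceFlow_eq P fun v => (hf.1 v).trans (hN v)

variable [DecidableEq H]

theorem mem_potentialProblem_feasible {π : H → ℝ} :
    π ∈ (N.potentialProblem P).feasible ↔
      ∀ e, N.lower e ≤ N.faceFlow P π e ∧ (N.faceFlow P π e : WithTop ℝ) ≤ N.cap e := by
  have h1 : ∀ e, ((π (P.dualGraph.dst (e, true)) - π (P.dualGraph.src (e, true)) : ℝ) : WithTop ℝ)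
      ≤ N.dartCap (e, true) ↔ (N.faceFlow P π e : WithTop ℝ) ≤ N.cap e := fun e => Iff.rfl
  have h2 : ∀ e, ((π (P.dualGraph.dst (e, false)) - π (P.dualGraph.src (e, false)) : ℝ) :
      WithTop ℝ) ≤ N.dartCap (e, false) ↔ N.lower e ≤ N.faceFlow P π e := fun e => by
    have : N.dartCap (e, false) = ((-N.lower e : ℝ) : WithTop ℝ) := rfl
    rw [this, WithTop.coe_le_coe, le_neg, neg_sub]
    rfl
  change (∀ d : Dart E, _) ↔ _
  rw [Prod.forall]
  simp only [Bool.forall_bool, h1, h2]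

theorem faceFlow_mem_feasible_iff [DecidableEq V] (hN : N.IsCirculation) (π : H → ℝ) :
    N.faceFlow P π ∈ N.minCostFlow.feasible ↔ π ∈ (N.potentialProblem P).feasible := by
  rw [mem_potentialProblem_feasible]
  refine ⟨fun h => h.2, fun h => ⟨fun v => ?_, h⟩⟩
  rw [hN v]
  exact N.faceFlow_mem_circulations P π v

theorem minCostFlow_objective_faceFlow [DecidableEq V] (π : H → ℝ) :
    N.minCostFlow.objective (N.faceFlow P π) = (N.potentialProblem P).objective π := by
  have h : ∀ q : E → H, ∑ h, (∑ e with q e = h, N.cost e) * π h = ∑ e, N.cost e * π (q e) := by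
    intro q
    rw [← Finset.sum_fiberwise Finset.univ q]
    refine Finset.sum_congr rfl fun h _ => ?_
    rw [Finset.sum_mul]
    exact Finset.sum_congr rfl fun e he => by rw [(Finset.mem_filter.1 he).2]
  simp only [minCostFlow, potentialProblem, faceCost, faceFlow, sub_mul, mul_sub,
    Finset.sum_sub_distrib, h]

theorem isOptimal_faceFlow_iff [DecidableEq V] (hN : N.IsCirculation) (π : H → ℝ) :
    (N.potentialProblem P).IsOptimal π ↔ N.minCostFlow.IsOptimal (N.faceFlow P π) := by
  refine and_congr (N.faceFlow_mem_feasible_iff P hN π).symm ⟨fun h f hf => ?_, fun h π' hπ' => ?_⟩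
  · obtain ⟨π', rfl⟩ := N.exists_faceFlow_eq_of_feasible P hN hf
    rw [minCostFlow_objective_faceFlow, minCostFlow_objective_faceFlow]
    exact h π' ((N.faceFlow_mem_feasible_iff P hN π').1 hf)
  · rw [← minCostFlow_objective_faceFlow, ← minCostFlow_objective_faceFlow]
    exact h _ ((N.faceFlow_mem_feasible_iff P hN π').2 hπ')

theorem value_minCostFlow_eq [DecidableEq V] (hN : N.IsCirculation) :
    N.minCostFlow.value = (N.potentialProblem P).value := by
  refine le_antisymm (le_iInf₂ fun π hπ => ?_) (le_iInf₂ fun f hf => ?_)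
  · rw [← minCostFlow_objective_faceFlow]
    exact iInf₂_le _ ((N.faceFlow_mem_feasible_iff P hN π).2 hπ)
  · obtain ⟨π, rfl⟩ := N.exists_faceFlow_eq_of_feasible P hN hf
    rw [minCostFlow_objective_faceFlow]
    exact iInf₂_le _ ((N.faceFlow_mem_feasible_iff P hN π).1 hf)

/-! ### The linear programming dual -/

theorem potentialLP_mulVec (π : H → ℝ) (a : N.LpdArc) :
    Matrix.mulVec (N.potentialLP P).A π a =
      π ((N.lpd P).head a) - π ((N.lpd P).tail a) := by
  simp only [potentialLP, Matrix.mulVec, dotProduct, Matrix.of_apply, sub_mul, ite_mul, one_mul,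
    zero_mul, Finset.sum_sub_distrib, Finset.sum_ite_eq, Finset.mem_univ, if_true]
  rfl

theorem potentialLP_feasible :
    (N.potentialLP P).feasible = (N.potentialProblem P).feasible := by
  ext π
  refine ⟨fun h d => ?_, fun h a => ?_⟩
  · by_cases hd : N.dartCap d = ⊤
    · rw [hd]
      exact le_top
    · have := h ⟨d, hd⟩
      rw [potentialLP_mulVec] at this
      rw [← N.coe_lpdCost ⟨d, hd⟩]
      exact WithTop.coe_le_coe.2 this
  · rw [potentialLP_mulVec]
    have := h a.1
    rw [← N.coe_lpdCost a] at this
    exact WithTop.coe_le_coe.1 this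

theorem potentialLP_objective (π : H → ℝ) :
    dotProduct (N.potentialLP P).c π = -(N.potentialProblem P).objective π := by
  simp [potentialLP, potentialProblem, dotProduct]

theorem dual_potentialLP : (N.potentialLP P).dual = (N.lpd P).minCostFlow := by
  refine MinProblem.ext ?_ rfl
  ext φ
  refine and_congr ?_ ⟨fun h a => ⟨h a, le_top⟩, fun h a => (h a).1⟩
  rw [funext_iff]
  refine forall_congr' fun h => ?_
  simp only [potentialLP, lpd, Matrix.mulVec, dotProduct, Matrix.of_apply, Matrix.transpose_apply,
    sub_mul, ite_mul, one_mul, zero_mul, Finset.sum_sub_distrib, ← Finset.sum_filter]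
  -- The dual equation reads inflow minus outflow equals `-c(h)`; negation gives the flow balance.
  rw [← neg_inj, neg_neg, neg_sub]
  exact Iff.rfl

/-- Lower bounds are finite, so every dual arc occurs in reverse, and the dual of `G` is connected
even when `G` is not. -/
theorem lpd_connected : (N.lpd P).underlying.Connected := by
  refine (SimpleGraph.connected_iff _).2 ⟨fun g h => ?_, P.nonempty_faces⟩
  refine SimpleGraph.ConnectedComponent.exact (P.eq_of_left_eq_right (fun e => ?_) g h)
  exact ((N.lpd P).connectedComponentMk_head ⟨(e, false), N.dartCap_false_ne_top e⟩).symm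

theorem isPlanar_lpd : IsPlanar (N.lpd P).toMultiDigraph :=
  isPlanar_ofDarts (G := P.dualGraph) N.dartCap_false_ne_top (N.lpd_connected P) (ρ := P.dualRot)
    (fun d => by rw [P.src_dualGraph, P.src_dualGraph, P.left_dualRot]) P.orbitCount_dualRot_le

end FlowNetwork

end PlanarDuality

/-! ### The main theorem. -/

theorem mainTheorem1 {V E H : Type*} [Fintype V] [DecidableEq V] [Fintype E]
    [Fintype H] [DecidableEq H]
    (N : PlanarDuality.FlowNetwork V E) (hN : N.IsCirculation)
    (P : PlanarDuality.PlaneEmbedding N.toMultiDigraph H) :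
    -- the potential problem is the circulation problem, rewritten on the dual graph
    ((∀ π : H → ℝ, N.faceFlow P π ∈ N.minCostFlow.feasible ↔
        π ∈ (N.potentialProblem P).feasible) ∧
      (∀ π : H → ℝ, N.minCostFlow.objective (N.faceFlow P π) =
        (N.potentialProblem P).objective π) ∧
      (∀ f ∈ N.minCostFlow.feasible, ∃ π : H → ℝ, N.faceFlow P π = f)) ∧
    -- the linear program `potentialLP` is the potential problem with negated objective
    ({π | ∀ a, Matrix.mulVec (N.potentialLP P).A π a ≤ (N.potentialLP P).b a} =
        (N.potentialProblem P).feasible ∧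
      ∀ π : H → ℝ, dotProduct (N.potentialLP P).c π = -(N.potentialProblem P).objective π) ∧
    -- its dual is the min-cost flow problem of the planar transshipment network `G^lpd`
    ((N.potentialLP P).dual = (N.lpd P).minCostFlow ∧
      (N.lpd P).IsTransshipment ∧
      PlanarDuality.IsPlanar (N.lpd P).toMultiDigraph) ∧
    -- `G^lpd` contains every dual arc in reverse direction, with cost `-ℓ(e)`, and also in its
    -- proper direction, with cost `u(e)`, if `u(e)` is finite; it contains no other arcs
    ((∀ e : E, ∃ a : N.LpdArc, a.1 = (e, false) ∧
        (N.lpd P).tail a = P.dualGraph.head e ∧ (N.lpd P).head a = P.dualGraph.tail e ∧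
        (N.lpd P).cost a = -N.lower e) ∧
      (∀ (e : E) (u : ℝ), N.cap e = (u : WithTop ℝ) → ∃ a : N.LpdArc, a.1 = (e, true) ∧
        (N.lpd P).tail a = P.dualGraph.tail e ∧ (N.lpd P).head a = P.dualGraph.head e ∧
        (N.lpd P).cost a = u) ∧
      (∀ e : E, N.cap e = ⊤ → ¬ ∃ a : N.LpdArc, a.1 = (e, true)) ∧
      Fintype.card N.LpdArc ≤ 2 * Fintype.card E) ∧
    -- equality of the optimal values
    (N.minCostFlow.value = (N.potentialProblem P).value ∧
      (N.minCostFlow.feasible.Nonempty ∨ (N.lpd P).minCostFlow.feasible.Nonempty →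
        N.minCostFlow.value = -(N.lpd P).minCostFlow.value) ∧
      (N.minCostFlow.feasible.Nonempty ∧ (N.lpd P).minCostFlow.feasible.Nonempty →
        (∃ f, N.minCostFlow.IsOptimal f) ∧ (∃ π, (N.potentialProblem P).IsOptimal π) ∧
        ∃ φ, (N.lpd P).minCostFlow.IsOptimal φ)) ∧
    -- recovery of an optimal circulation from face potentials, and of optimal face potentials
    -- from an optimal transshipment
    ((∀ π : H → ℝ, (N.potentialProblem P).IsOptimal π ↔
        N.minCostFlow.IsOptimal (N.faceFlow P π)) ∧
      (∀ φ : N.LpdArc → ℝ, (N.lpd P).minCostFlow.IsOptimal φ → ∀ π : H → ℝ,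
        ((N.potentialProblem P).IsOptimal π ↔ ∀ a : N.LpdArc,
          π ((N.lpd P).head a) ≤ π ((N.lpd P).tail a) + (N.lpd P).cost a ∧
          (0 < φ a → π ((N.lpd P).tail a) ≤ π ((N.lpd P).head a) - (N.lpd P).cost a)))) := by
  have hf := N.potentialLP_feasible P
  have ho := N.potentialLP_objective P
  have hdual := N.dual_potentialLP P
  have hPC : N.minCostFlow.feasible.Nonempty → (N.potentialProblem P).feasible.Nonempty := by
    rintro ⟨f, h⟩
    obtain ⟨π, rfl⟩ := N.exists_faceFlow_eq_of_feasible P hN h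
    exact ⟨π, (N.faceFlow_mem_feasible_iff P hN π).1 h⟩
  refine ⟨⟨N.faceFlow_mem_feasible_iff P hN, N.minCostFlow_objective_faceFlow P,
    fun f => N.exists_faceFlow_eq_of_feasible P hN⟩, ⟨hf, ho⟩,
    ⟨hdual, fun _ => ⟨rfl, rfl⟩, N.isPlanar_lpd P⟩, ⟨fun e => ?_, fun e u hu => ?_, fun e he => ?_, ?_⟩,
    ⟨N.value_minCostFlow_eq P hN, fun h => ?_, fun h => ?_⟩,
    ⟨N.isOptimal_faceFlow_iff P hN, fun φ hφ π => ?_⟩⟩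
  · exact ⟨⟨(e, false), N.dartCap_false_ne_top e⟩, rfl, rfl, rfl, rfl⟩
  · have hd : N.dartCap (e, true) = (u : WithTop ℝ) := hu
    refine ⟨⟨(e, true), hd ▸ WithTop.coe_ne_top⟩, rfl, rfl, rfl, ?_⟩
    exact WithTop.coe_injective ((N.coe_lpdCost ⟨(e, true), _⟩).trans hd)
  · rintro ⟨a, ha⟩
    exact a.2 (ha ▸ he)
  · refine (Fintype.card_subtype_le _).trans ?_
    rw [Fintype.card_prod, Fintype.card_bool, mul_comm]
  · rw [N.value_minCostFlow_eq P hN, ← hdual]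
    exact PlanarDuality.LinearProgram.value_eq_neg_value_dual hf ho (hdual ▸ h.imp_left hPC)
  · obtain ⟨π, φ, hπ, hφ, -⟩ :=
      PlanarDuality.LinearProgram.exists_isOptimal hf ho (hPC h.1) (hdual ▸ h.2)
    exact ⟨⟨_, (N.isOptimal_faceFlow_iff P hN π).1 hπ⟩, ⟨π, hπ⟩, ⟨φ, hdual ▸ hφ⟩⟩
  · rw [PlanarDuality.LinearProgram.isOptimal_iff_complementary_slackness hf ho (hdual ▸ hφ)]
    refine forall_congr' fun a => ?_
    have hb : (N.potentialLP P).b a = (N.lpd P).cost a := rfl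
    rw [N.potentialLP_mulVec, hb, sub_le_iff_le_add', le_sub_comm]
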